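/- **Theorem (Truncation error).** Let $d\ge 1$, let $\Omega\subset\mathbb R^d$ be a bounded convex open set containing the origin, and for $M>0$, $t>0$ put $$\Omega^M(t)=\begin{cases}(1+t(1+M))\,\Omega, & t\ge 1,\\ (2+M)\,\Omega, & t<1,\end{cases}\qquad B^M(t)=\{x\in\Omega^M(t):\operatorname{dist}(x,\partial\Omega^M(t))<t\}.$$ Let $D\subset\Omega$ be open. For $\eta\in L^2(D)$ let $\widetilde\eta$ be its extension by zero, let $v(\widetilde\eta,t)\in H^1(\mathbb R^d)$ solve $$\int_{\mathbb R^d} v\phi+t^2\int_{\mathbb R^d}\nabla v\cdot\nabla\phi=-\int_{\mathbb R^d}\widetilde\eta\,\phi\qquad\text{for all }\phi\in H^1(\mathbb R^d),$$ let $v^M(\widetilde\eta,t)\in H^1_0(\Omega^M(t))$ solve the same problem with $\mathbb R^d$ replaced by $\Omega^M(t)$ and $H^1(\mathbb R^d)$ by $H^1_0(\Omega^M(t))$, and put $w(\widetilde\eta,t)=\widetilde\eta+v(\widetilde\eta,t)=-t^2\Delta(I-t^2\Delta)^{-1}\widetilde\eta$ and $w^M(\widetilde\eta,t)=\widetilde\eta+v^M(\widetilde\eta,t)$.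 For $s\in(0,1)$, $k>0$, nonnegative integers $N^-,N^+$, with $y_j=jk$, $t_j=e^{-y_j/2}$ and $c_s=2\sin(\pi s)/\pi$, define for $\eta,\theta\in L^2(D)$ $$a^k(\eta,\theta)=\frac{c_sk}{2}\sum_{j=-N^-}^{N^+}e^{sy_j}\int_D w(\widetilde\eta,t_j)\,\theta\,dx,\qquad a^{k,M}(\eta,\theta)=\frac{c_sk}{2}\sum_{j=-N^-}^{N^+}e^{sy_j}\int_D w^M(\widetilde\eta,t_j)\,\theta\,dx.$$ Consider, for constants $c$ and $C_1$, the decay estimate $$t\|\nabla v(\widetilde\eta,t)\|_{L^2(B^M(t))}+\|v(\widetilde\eta,t)\|_{L^2(B^M(t))}\le C_1e^{-\max(1,t)\,cM/t}\,\|\eta\|_{L^2(D)}\quad\text{for all } M>0,\ t>0,\ \eta\in L^2(D).\tag{1}$$ (i) There are constants $c,C_1>0$, depending only on $\Omega$, such that (1) holds for every open $D\subset\Omega$. (ii) Let $c>0$ and $C_1$ be constants and let $k_0>0$. There is a constant $C>0$, depending only on $\Omega$, $c$, $C_1$ and $k_0$, and in particular independent of $M$ and $k$ (and of $D$, $s$,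 $N^-$, $N^+$), such that, whenever (1) holds for $D$ with the constants $c$, $C_1$, $s\in(0,1)$, $M>2(s+1)/c$ and $0<k\le k_0$, $$|a^k(\eta,\theta)-a^{k,M}(\eta,\theta)|\le C\,e^{-cM}\,\|\eta\|_{L^2(D)}\,\|\theta\|_{L^2(D)}\qquad\text{for all }\eta,\theta\in L^2(D).$$ -/

import Mathlib

open MeasureTheory Set
open scoped Pointwise ContDiff Gradient RealInnerProductSpace

noncomputable section

namespace FracTrunc

/-- The space `ℝ^d` with its Euclidean norm. -/
abbrev Eucl (d : ℕ) := EuclideanSpace ℝ (Fin d)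

variable {d : ℕ}

/-- The norm of `L²(U)`, for scalar functions and for vector fields. -/
def l2Norm {F : Type*} [NormedAddCommGroup F] (U : Set (Eucl d)) (f : Eucl d → F) : ℝ :=
  (eLpNorm f 2 (volume.restrict U)).toReal

/-- Test functions: `φ ∈ C_c^∞(U)`. -/
def IsTest (U : Set (Eucl d)) (φ : Eucl d → ℝ) : Prop :=
  ContDiff ℝ ∞ φ ∧ HasCompactSupport φ ∧ tsupport φ ⊆ U

/-- `u ∈ H¹(U)` with weak gradient `g`: both are square integrable on `U`, and
`∫_U u ∂_e φ = - ∫_U (g · e) φ` for all test functions `φ` and all directions `e`. -/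
def MemH1 (U : Set (Eucl d)) (u : Eucl d → ℝ) (g : Eucl d → Eucl d) : Prop :=
  MemLp u 2 (volume.restrict U) ∧ MemLp g 2 (volume.restrict U) ∧
    ∀ φ, IsTest U φ → ∀ e : Eucl d,
      ∫ x in U, u x * fderiv ℝ φ x e = - ∫ x in U, ⟪g x, e⟫ * φ x

/-- `u ∈ H¹₀(U)` with weak gradient `g`: `(u, g)` is the limit, in `L²(U) × L²(U; ℝ^d)`,
of pairs `(φ, ∇ φ)` with `φ ∈ C_c^∞(U)`. -/
def MemH10 (U : Set (Eucl d)) (u : Eucl d → ℝ) (g : Eucl d → Eucl d) : Prop :=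
  MemLp u 2 (volume.restrict U) ∧ MemLp g 2 (volume.restrict U) ∧
    ∀ ε : ℝ, 0 < ε → ∃ φ, IsTest U φ ∧
      eLpNorm (fun x => u x - φ x) 2 (volume.restrict U) < ENNReal.ofReal ε ∧
      eLpNorm (fun x => g x - ∇ φ x) 2 (volume.restrict U) < ENNReal.ofReal ε

/-- `v`, with weak gradient `g`, lies in the space `V` of functions on `U` and satisfies
`(v, φ)_U + t² d_U(v, φ) = -(ψ, φ)_U` for all `φ` in `V`. -/
def IsWeakSol (V : (Eucl d → ℝ) → (Eucl d → Eucl d) → Prop) (U : Set (Eucl d)) (t : ℝ)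
    (ψ : Eucl d → ℝ) (v : Eucl d → ℝ) (g : Eucl d → Eucl d) : Prop :=
  V v g ∧ ∀ φ h, V φ h →
    (∫ x in U, v x * φ x) + t ^ 2 * (∫ x in U, ⟪g x, h x⟫) = - ∫ x in U, ψ x * φ x

/-- `v = v(ψ,t) ∈ H¹(ℝ^d)`, with gradient `g`, solves
`(v, φ) + t² d(v, φ) = -(ψ, φ)` for all `φ ∈ H¹(ℝ^d)`; that is, `v = -(I - t² Δ)⁻¹ ψ`. -/
def IsWholeSol (t : ℝ) (ψ v : Eucl d → ℝ) (g : Eucl d → Eucl d) : Prop :=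
  IsWeakSol (MemH1 univ) univ t ψ v g

/-- `v ∈ H¹₀(U)`, with gradient `g`, solves
`(v, φ)_U + t² d_U(v, φ) = -(ψ, φ)_U` for all `φ ∈ H¹₀(U)`. -/
def IsDirichletSol (U : Set (Eucl d)) (t : ℝ) (ψ v : Eucl d → ℝ) (g : Eucl d → Eucl d) : Prop :=
  IsWeakSol (MemH10 U) U t ψ v g

/-! ### Well-posedness of the two problems -/

section wellposed

variable {U : Set (Eucl d)} {t : ℝ} {ψ : Eucl d → ℝ}

/-- The space `V` is given by a closed linear subspace of `L²(U) × L²(U; ℝ^d)`. -/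
def IsClosedForm (V : (Eucl d → ℝ) → (Eucl d → Eucl d) → Prop) (U : Set (Eucl d)) : Prop :=
  ∃ K : Submodule ℝ (Lp ℝ 2 (volume.restrict U) × Lp (Eucl d) 2 (volume.restrict U)),
    IsClosed (K : Set (Lp ℝ 2 (volume.restrict U) × Lp (Eucl d) 2 (volume.restrict U))) ∧ ∀ u g, V u g ↔
      ∃ (hu : MemLp u 2 (volume.restrict U)) (hg : MemLp g 2 (volume.restrict U)),
        (hu.toLp u, hg.toLp g) ∈ K

theorem integral_mul_eq {u v : Eucl d → ℝ} (hu : MemLp u 2 (volume.restrict U))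
    (hv : MemLp v 2 (volume.restrict U)) :
    ∫ x in U, u x * v x = ⟪hu.toLp u, hv.toLp v⟫ := by
  rw [L2.inner_def]
  refine integral_congr_ae ?_
  filter_upwards [hu.coeFn_toLp, hv.coeFn_toLp] with x h1 h2
  rw [h1, h2]; simp [mul_comm]

theorem integral_inner_eq {u v : Eucl d → Eucl d} (hu : MemLp u 2 (volume.restrict U))
    (hv : MemLp v 2 (volume.restrict U)) :
    ∫ x in U, ⟪u x, v x⟫ = ⟪hu.toLp u, hv.toLp v⟫ := by
  rw [L2.inner_def]
  refine integral_congr_ae ?_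
  filter_upwards [hu.coeFn_toLp, hv.coeFn_toLp] with x h1 h2
  rw [h1, h2]

theorem IsClosedForm.exists_weakSol {V : (Eucl d → ℝ) → (Eucl d → Eucl d) → Prop}
    (hV : IsClosedForm V U) (ht : 0 < t) (hψ : MemLp ψ 2 (volume.restrict U)) :
    ∃ v g, IsWeakSol V U t ψ v g := by
  obtain ⟨K, hK, hVK⟩ := hV
  let A := Lp ℝ 2 (volume.restrict U)
  let B := Lp (Eucl d) 2 (volume.restrict U)
  let S : WithLp 2 (A × B) →L[ℝ] A × B :=
    ((ContinuousLinearMap.fst ℝ A B).prod (t⁻¹ • ContinuousLinearMap.snd ℝ A B)).comp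
      (WithLp.prodContinuousLinearEquiv 2 ℝ A B : WithLp 2 (A × B) →L[ℝ] A × B)
  let Kt : Submodule ℝ (WithLp 2 (A × B)) := K.comap (S : WithLp 2 (A × B) →ₗ[ℝ] A × B)
  have hKt : IsClosed (Kt : Set (WithLp 2 (A × B))) := hK.preimage S.continuous
  have : CompleteSpace Kt := hKt.completeSpace_coe
  let f : WithLp 2 (A × B) := WithLp.toLp 2 (-(hψ.toLp ψ), 0)
  let p : WithLp 2 (A × B) := Kt.starProjection f
  have hp : p ∈ Kt := Submodule.starProjection_apply_mem Kt f
  have hpK : (p.fst, t⁻¹ • p.snd) ∈ K := hp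
  refine ⟨p.fst, ((t⁻¹ • p.snd : B) : Eucl d → Eucl d), ?_, ?_⟩
  · rw [hVK]
    refine ⟨Lp.memLp _, Lp.memLp _, ?_⟩
    rw [Lp.toLp_coeFn, Lp.toLp_coeFn]
    exact hpK
  · intro φ h hφ
    obtain ⟨hφ1, hφ2, hm⟩ := (hVK φ h).1 hφ
    let q : WithLp 2 (A × B) := WithLp.toLp 2 (hφ1.toLp φ, t • hφ2.toLp h)
    have hq : q ∈ Kt := by
      change (hφ1.toLp φ, t⁻¹ • t • hφ2.toLp h) ∈ K
      rw [smul_smul, inv_mul_cancel₀ ht.ne', one_smul]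
      exact hm
    have hproj : ⟪f - p, q⟫ = 0 := Submodule.starProjection_inner_eq_zero f q hq
    rw [inner_sub_left, sub_eq_zero] at hproj
    rw [WithLp.prod_inner_apply, WithLp.prod_inner_apply] at hproj
    have e1 : ∫ x in U, (p.fst : Eucl d → ℝ) x * φ x = ⟪p.fst, hφ1.toLp φ⟫ := by
      rw [integral_mul_eq (Lp.memLp _) hφ1, Lp.toLp_coeFn]
    have e2 : ∫ x in U, ⟪((t⁻¹ • p.snd : B) : Eucl d → Eucl d) x, h x⟫
        = ⟪(t⁻¹ • p.snd : B), hφ2.toLp h⟫ := by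
      rw [integral_inner_eq (Lp.memLp _) hφ2, Lp.toLp_coeFn]
    rw [e1, e2, integral_mul_eq hψ hφ1]
    have hpr : ⟪-(hψ.toLp ψ), hφ1.toLp φ⟫ + ⟪(0 : B), t • hφ2.toLp h⟫
        = ⟪p.fst, hφ1.toLp φ⟫ + ⟪p.snd, t • hφ2.toLp h⟫ := hproj
    rw [inner_neg_left, inner_zero_left, inner_smul_right] at hpr
    rw [real_inner_smul_left]
    have : t ^ 2 * (t⁻¹ * ⟪p.snd, hφ2.toLp h⟫) = t * ⟪p.snd, hφ2.toLp h⟫ := by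
      field_simp
    rw [this]
    linarith

theorem IsClosedForm.ae_eq {V : (Eucl d → ℝ) → (Eucl d → Eucl d) → Prop}
    (hV : IsClosedForm V U) {v v' : Eucl d → ℝ} {g g' : Eucl d → Eucl d}
    (h : IsWeakSol V U t ψ v g) (h' : IsWeakSol V U t ψ v' g') :
    v =ᵐ[volume.restrict U] v' := by
  obtain ⟨K, hK, hVK⟩ := hV
  obtain ⟨a, b, hm⟩ := (hVK v g).1 h.1
  obtain ⟨a', b', hm'⟩ := (hVK v' g').1 h'.1
  have hd : V (v - v') (g - g') := by
    rw [hVK]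
    exact ⟨a.sub a', b.sub b', K.sub_mem hm hm'⟩
  have h1 := h.2 _ _ hd
  have h2 := h'.2 _ _ hd
  rw [integral_mul_eq a (a.sub a'), integral_inner_eq b (b.sub b')] at h1
  rw [integral_mul_eq a' (a.sub a'), integral_inner_eq b' (b.sub b')] at h2
  rw [MemLp.toLp_sub a a', MemLp.toLp_sub b b'] at h1 h2
  have h3 : ⟪a.toLp v - a'.toLp v', a.toLp v - a'.toLp v'⟫
      + t ^ 2 * ⟪b.toLp g - b'.toLp g', b.toLp g - b'.toLp g'⟫ = 0 := by
    rw [inner_sub_left (a.toLp v), inner_sub_left (b.toLp g)]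
    linarith
  rw [real_inner_self_eq_norm_sq, real_inner_self_eq_norm_sq] at h3
  have h4 : ‖a.toLp v - a'.toLp v'‖ = 0 := by
    have : 0 ≤ t ^ 2 * ‖b.toLp g - b'.toLp g'‖ ^ 2 := by positivity
    have : ‖a.toLp v - a'.toLp v'‖ ^ 2 = 0 := by
      have := sq_nonneg ‖a.toLp v - a'.toLp v'‖
      linarith
    simpa using this
  exact (MemLp.toLp_eq_toLp_iff a a').1 (sub_eq_zero.1 (norm_eq_zero.1 h4))

theorem IsTest.memLp {φ : Eucl d → ℝ} (h : IsTest U φ) : MemLp φ 2 (volume.restrict U) :=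
  h.1.continuous.memLp_of_hasCompactSupport h.2.1

theorem IsTest.memLp_fderiv {φ : Eucl d → ℝ} (h : IsTest U φ) (e : Eucl d) :
    MemLp (fun x => fderiv ℝ φ x e) 2 (volume.restrict U) :=
  ((h.1.continuous_fderiv (by simp)).clm_apply continuous_const).memLp_of_hasCompactSupport
    (h.2.1.fderiv_apply (𝕜 := ℝ) e)

theorem IsTest.memLp_smul {φ : Eucl d → ℝ} (h : IsTest U φ) (e : Eucl d) :
    MemLp (fun x => φ x • e) 2 (volume.restrict U) :=
  (h.1.continuous.smul continuous_const).memLp_of_hasCompactSupport h.2.1.smul_right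

theorem IsTest.memLp_gradient {φ : Eucl d → ℝ} (h : IsTest U φ) :
    MemLp (∇ φ) 2 (volume.restrict U) := by
  have h1 : Continuous (∇ φ) :=
    (InnerProductSpace.toDual ℝ (Eucl d)).symm.continuous.comp (h.1.continuous_fderiv (by simp))
  have h2 : HasCompactSupport (∇ φ) :=
    (h.2.1.fderiv (𝕜 := ℝ)).comp_left (g := (InnerProductSpace.toDual ℝ (Eucl d)).symm) (by simp)
  exact h1.memLp_of_hasCompactSupport h2

theorem isClosedForm_memH1 (U : Set (Eucl d)) : IsClosedForm (MemH1 U) U := by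
  let A := Lp ℝ 2 (volume.restrict U)
  let B := Lp (Eucl d) 2 (volume.restrict U)
  let L (φ : Eucl d → ℝ) (h : IsTest U φ) (e : Eucl d) : A × B →L[ℝ] ℝ :=
    ((innerSL ℝ ((h.memLp_fderiv e).toLp _)).comp (ContinuousLinearMap.fst ℝ A B))
      + ((innerSL ℝ ((h.memLp_smul e).toLp _)).comp (ContinuousLinearMap.snd ℝ A B))
  refine ⟨⨅ φ, ⨅ h : IsTest U φ, ⨅ e, (L φ h e).ker, ?_, ?_⟩
  · simp only [Submodule.coe_iInf]
    exact isClosed_iInter fun φ => isClosed_iInter fun h => isClosed_iInter fun e =>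
      (L φ h e).isClosed_ker
  · intro u g
    have key : ∀ (hu : MemLp u 2 (volume.restrict U)) (hg : MemLp g 2 (volume.restrict U))
        (φ) (h : IsTest U φ) (e), (hu.toLp u, hg.toLp g) ∈ (L φ h e).ker ↔
        ∫ x in U, u x * fderiv ℝ φ x e = - ∫ x in U, ⟪g x, e⟫ * φ x := by
      intro hu hg φ h e
      have e1 : L φ h e (hu.toLp u, hg.toLp g)
          = (∫ x in U, u x * fderiv ℝ φ x e) + ∫ x in U, ⟪g x, e⟫ * φ x := by
        change ⟪(h.memLp_fderiv e).toLp _, hu.toLp u⟫ + ⟪(h.memLp_smul e).toLp _, hg.toLp g⟫ = _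
        rw [← integral_mul_eq, ← integral_inner_eq]
        congr 1
        · simp only [mul_comm]
        · refine integral_congr_ae (Filter.Eventually.of_forall fun x => ?_)
          change ⟪φ x • e, g x⟫ = ⟪g x, e⟫ * φ x
          rw [real_inner_smul_left, real_inner_comm, mul_comm]
      rw [LinearMap.mem_ker]
      change L φ h e (hu.toLp u, hg.toLp g) = 0 ↔ _
      rw [e1, eq_neg_iff_add_eq_zero]
    constructor
    · rintro ⟨hu, hg, hw⟩
      refine ⟨hu, hg, ?_⟩
      simp only [Submodule.mem_iInf]
      exact fun φ h e => (key hu hg φ h e).2 (hw φ h e)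
    · rintro ⟨hu, hg, hw⟩
      simp only [Submodule.mem_iInf] at hw
      exact ⟨hu, hg, fun φ h e => (key hu hg φ h e).1 (hw φ h e)⟩

theorem IsTest.zero : IsTest U (0 : Eucl d → ℝ) :=
  ⟨contDiff_const, HasCompactSupport.zero, by simp [tsupport]⟩

theorem IsTest.add {φ χ : Eucl d → ℝ} (h : IsTest U φ) (h' : IsTest U χ) : IsTest U (φ + χ) :=
  ⟨h.1.add h'.1, h.2.1.add h'.2.1, (tsupport_add φ χ).trans (union_subset h.2.2 h'.2.2)⟩

theorem IsTest.const_smul {φ : Eucl d → ℝ} (h : IsTest U φ) (c : ℝ) : IsTest U (c • φ) :=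
  ⟨h.1.const_smul c, h.2.1.smul_left (f := fun _ => c),
    (tsupport_smul_subset_right (fun _ => c) φ).trans h.2.2⟩

theorem isClosedForm_memH10 (U : Set (Eucl d)) : IsClosedForm (MemH10 U) U := by
  let A := Lp ℝ 2 (volume.restrict U)
  let B := Lp (Eucl d) 2 (volume.restrict U)
  let K0 : Submodule ℝ (A × B) :=
    { carrier := {p | ∃ (φ : Eucl d → ℝ) (h : IsTest U φ),
        p = (h.memLp.toLp φ, h.memLp_gradient.toLp (∇ φ))}
      add_mem' := by
        rintro _ _ ⟨φ, h, rfl⟩ ⟨χ, h', rfl⟩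
        refine ⟨φ + χ, h.add h', Prod.ext rfl ?_⟩
        change h.memLp_gradient.toLp (∇ φ) + h'.memLp_gradient.toLp (∇ χ) = _
        rw [← MemLp.toLp_add]
        congr 1
        funext x
        simp only [Pi.add_apply, gradient]
        rw [fderiv_add (h.1.differentiable (by simp) x) (h'.1.differentiable (by simp) x), map_add]
      zero_mem' := by
        refine ⟨0, IsTest.zero, Prod.ext rfl ?_⟩
        change (0 : B) = _
        symm
        rw [Lp.eq_zero_iff_ae_eq_zero]
        refine (IsTest.zero (U := U)).memLp_gradient.coeFn_toLp.trans (Filter.Eventually.of_forall fun x => ?_)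
        simp [gradient]
      smul_mem' := by
        rintro c _ ⟨φ, h, rfl⟩
        refine ⟨c • φ, h.const_smul c, Prod.ext rfl ?_⟩
        change c • h.memLp_gradient.toLp (∇ φ) = _
        rw [← MemLp.toLp_const_smul]
        congr 1
        funext x
        simp only [Pi.smul_apply, gradient]
        rw [fderiv_const_smul (h.1.differentiable (by simp) x)]
        simp }
  refine ⟨K0.topologicalClosure, K0.isClosed_topologicalClosure, fun u g => ?_⟩
  have key : ∀ (hu : MemLp u 2 (volume.restrict U)) (hg : MemLp g 2 (volume.restrict U))
      (φ) (h : IsTest U φ) (ε : ℝ),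
      dist (hu.toLp u, hg.toLp g) (h.memLp.toLp φ, h.memLp_gradient.toLp (∇ φ)) < ε ↔
        eLpNorm (fun x => u x - φ x) 2 (volume.restrict U) < ENNReal.ofReal ε ∧
        eLpNorm (fun x => g x - ∇ φ x) 2 (volume.restrict U) < ENNReal.ofReal ε := by
    intro hu hg φ h ε
    rw [Prod.dist_eq, max_lt_iff, dist_eq_norm, dist_eq_norm, ← MemLp.toLp_sub, ← MemLp.toLp_sub,
      Lp.norm_toLp, Lp.norm_toLp,
      ← ENNReal.lt_ofReal_iff_toReal_lt (hu.sub h.memLp).eLpNorm_ne_top,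
      ← ENNReal.lt_ofReal_iff_toReal_lt (hg.sub h.memLp_gradient).eLpNorm_ne_top]
    rfl
  have cl : ∀ p : A × B, p ∈ K0.topologicalClosure ↔ ∀ ε > 0, ∃ q ∈ K0, dist p q < ε :=
    fun p => Metric.mem_closure_iff
  constructor
  · rintro ⟨hu, hg, hw⟩
    refine ⟨hu, hg, (cl _).2 fun ε hε => ?_⟩
    obtain ⟨φ, h, h1⟩ := hw ε hε
    exact ⟨_, ⟨φ, h, rfl⟩, (key hu hg φ h ε).2 h1⟩
  · rintro ⟨hu, hg, hw⟩
    refine ⟨hu, hg, fun ε hε => ?_⟩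
    obtain ⟨_, ⟨φ, h, rfl⟩, h1⟩ := (cl _).1 hw ε hε
    exact ⟨φ, h, (key hu hg φ h ε).1 h1⟩

end wellposed

theorem exists_wholeSol {t : ℝ} (ht : 0 < t) {ψ : Eucl d → ℝ} (hψ : MemLp ψ 2 volume) :
    ∃ v g, IsWholeSol t ψ v g :=
  (isClosedForm_memH1 univ).exists_weakSol ht (by simpa using hψ)

theorem exists_dirichletSol {t : ℝ} (ht : 0 < t) {U : Set (Eucl d)} {ψ : Eucl d → ℝ}
    (hψ : MemLp ψ 2 (volume.restrict U)) : ∃ v g, IsDirichletSol U t ψ v g :=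
  (isClosedForm_memH10 U).exists_weakSol ht hψ

open Classical in
/-- The solution `v(ψ,t)` of the whole-space problem; it exists for all `t > 0` and
`ψ ∈ L²(ℝ^d)` (the default value `0` is not used then) and is unique almost everywhere. -/
def vWhole (t : ℝ) (ψ : Eucl d → ℝ) : Eucl d → ℝ :=
  if h : ∃ v g, IsWholeSol t ψ v g then h.choose else 0

open Classical in
/-- The solution of the Dirichlet problem on `U`; it exists for all `t > 0` and
`ψ ∈ L²(U)` (the default value `0` is not used then) and is unique almost everywhere. -/
def vDirichlet (U : Set (Eucl d)) (t : ℝ) (ψ : Eucl d → ℝ) : Eucl d → ℝ :=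
  if h : ∃ v g, IsDirichletSol U t ψ v g then h.choose else 0

theorem vWhole_spec {t : ℝ} (ht : 0 < t) {ψ : Eucl d → ℝ} (hψ : MemLp ψ 2 volume) :
    ∃ g, IsWholeSol t ψ (vWhole t ψ) g := by
  have h := exists_wholeSol ht hψ
  rw [vWhole, dif_pos h]
  exact h.choose_spec

theorem vDirichlet_spec {t : ℝ} (ht : 0 < t) {U : Set (Eucl d)} {ψ : Eucl d → ℝ}
    (hψ : MemLp ψ 2 (volume.restrict U)) :
    ∃ g, IsDirichletSol U t ψ (vDirichlet U t ψ) g := by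
  have h := exists_dirichletSol ht hψ
  rw [vDirichlet, dif_pos h]
  exact h.choose_spec

theorem IsWholeSol.ae_eq {t : ℝ} {ψ v v' : Eucl d → ℝ} {g g' : Eucl d → Eucl d}
    (h : IsWholeSol t ψ v g) (h' : IsWholeSol t ψ v' g') : v =ᵐ[volume] v' := by
  simpa using (isClosedForm_memH1 univ).ae_eq h h'

theorem IsDirichletSol.ae_eq {t : ℝ} {U : Set (Eucl d)} {ψ v v' : Eucl d → ℝ}
    {g g' : Eucl d → Eucl d} (h : IsDirichletSol U t ψ v g) (h' : IsDirichletSol U t ψ v' g') :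
    v =ᵐ[volume.restrict U] v' :=
  (isClosedForm_memH10 U).ae_eq h h'

/-! ### Truncated domains and quadrature forms -/

/-- The dilated domain `Ω^M(t)`. -/
def dilatedDomain (Ω : Set (Eucl d)) (M t : ℝ) : Set (Eucl d) :=
  if 1 ≤ t then (1 + t * (1 + M)) • Ω else (2 + M) • Ω

/-- The boundary layer `B^M(t)` of width `t` in `Ω^M(t)`. -/
def boundaryLayer (Ω : Set (Eucl d)) (M t : ℝ) : Set (Eucl d) :=
  {x ∈ dilatedDomain Ω M t | Metric.infDist x (frontier (dilatedDomain Ω M t)) < t}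

/-- The extension by zero outside `D`. -/
abbrev zeroExt (D : Set (Eucl d)) (η : Eucl d → ℝ) : Eucl d → ℝ := D.indicator η

/-- The decay estimate with constants `c` and `C`, for data supported in `D`: with
`v = v(η̃,t)`,
`t ‖∇v‖_{L²(B^M(t))} + ‖v‖_{L²(B^M(t))} ≤ C exp(-max(1,t) c M / t) ‖η‖_{L²(D)}`
for all `M > 0`, `t > 0` and `η ∈ L²(D)`. -/
def DecayEstimate (Ω D : Set (Eucl d)) (c C : ℝ) : Prop :=
  ∀ M t : ℝ, 0 < M → 0 < t → ∀ η : Eucl d → ℝ, MemLp η 2 (volume.restrict D) →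
    ∀ v g, IsWholeSol t (zeroExt D η) v g →
      t * l2Norm (boundaryLayer Ω M t) g + l2Norm (boundaryLayer Ω M t) v
        ≤ C * Real.exp (-(max 1 t * c * M / t)) * l2Norm D η

/-- The constant `c_s = 2 sin(π s) / π`. -/
def cs (s : ℝ) : ℝ := 2 * Real.sin (Real.pi * s) / Real.pi

/-- The quadrature nodes `y_j = j k`. -/
def yNode (k : ℝ) (j : ℤ) : ℝ := j * k

/-- The points `t_j = exp(-y_j / 2)`. -/
def tNode (k : ℝ) (j : ℤ) : ℝ := Real.exp (-(yNode k j) / 2)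

/-- `w(ψ,t) = -t² Δ (I - t² Δ)⁻¹ ψ = ψ + v(ψ,t)`. -/
def wWhole (t : ℝ) (ψ : Eucl d → ℝ) : Eucl d → ℝ := fun x => ψ x + vWhole t ψ x

/-- The analogue of `w(ψ,t)` for the Dirichlet Laplacian on the dilated domain. -/
def wTrunc (Ω : Set (Eucl d)) (M t : ℝ) (ψ : Eucl d → ℝ) : Eucl d → ℝ :=
  fun x => ψ x + vDirichlet (dilatedDomain Ω M t) t ψ x

/-- The quadrature form
`a^k(η,θ) = (c_s k / 2) ∑_{j=-N⁻}^{N⁺} e^{s y_j} (w(η̃,t_j), θ)_D`. -/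
def aQuad (D : Set (Eucl d)) (s k : ℝ) (Nm Np : ℕ) (η θ : Eucl d → ℝ) : ℝ :=
  cs s * k / 2 * ∑ j ∈ Finset.Icc (-(Nm : ℤ)) (Np : ℤ), Real.exp (s * yNode k j) *
    ∫ x in D, wWhole (tNode k j) (zeroExt D η) x * θ x

/-- The truncated quadrature form
`a^{k,M}(η,θ) = (c_s k / 2) ∑_{j=-N⁻}^{N⁺} e^{s y_j} (w^M(η̃,t_j), θ)_D`. -/
def aQuadTrunc (Ω D : Set (Eucl d)) (M s k : ℝ) (Nm Np : ℕ) (η θ : Eucl d → ℝ) : ℝ :=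
  cs s * k / 2 * ∑ j ∈ Finset.Icc (-(Nm : ℤ)) (Np : ℤ), Real.exp (s * yNode k j) *
    ∫ x in D, wTrunc Ω M (tNode k j) (zeroExt D η) x * θ x

end FracTrunc

end

noncomputable section

namespace FracTrunc

open Metric ContinuousLinearMap
open scoped Convolution ENNReal NNReal

variable {d : ℕ}

/-- A bump function at the origin supported in the ball of radius `ε`. -/
def originBump {ε : ℝ} (hε : 0 < ε) : ContDiffBump (0 : Eucl d) :=
  ⟨ε / 2, ε, half_pos hε, half_lt_self hε⟩

theorem norm_gradient {φ : Eucl d → ℝ} (x : Eucl d) : ‖∇ φ x‖ = ‖fderiv ℝ φ x‖ :=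
  LinearIsometryEquiv.norm_map _ _

theorem inner_gradient {φ : Eucl d → ℝ} (x e : Eucl d) : ⟪∇ φ x, e⟫ = fderiv ℝ φ x e :=
  InnerProductSpace.toDual_symm_apply

theorem LipschitzWith.exists_contDiff_approx {K : ℝ≥0} {f : Eucl d → ℝ} (hf : LipschitzWith K f)
    {ε : ℝ} (hε : 0 < ε) :
    ∃ F : Eucl d → ℝ, ContDiff ℝ ∞ F ∧ (∀ x, ‖∇ F x‖ ≤ K) ∧ (∀ x, |F x - f x| ≤ K * ε) ∧
      ∀ x, (∀ y ∈ ball x ε, f y = f x) → F x = f x := by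
  let ρ : ContDiffBump (0 : Eucl d) := originBump hε
  have hfc : Continuous f := hf.continuous
  have hsmooth : ContDiff ℝ ∞ (ρ.normed volume ⋆[lsmul ℝ ℝ, volume] f) :=
    ρ.hasCompactSupport_normed.contDiff_convolution_left _ ρ.contDiff_normed hfc.locallyIntegrable
  have hex : ConvolutionExists (ρ.normed volume) f (lsmul ℝ ℝ) volume :=
    ρ.hasCompactSupport_normed.convolutionExists_left _ (ρ.contDiff_normed (n := 0)).continuous
      hfc.locallyIntegrable
  have hlip : LipschitzWith K (ρ.normed volume ⋆[lsmul ℝ ℝ, volume] f) := by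
    refine LipschitzWith.of_dist_le_mul fun x y => ?_
    rw [dist_eq_norm, convolution_def, convolution_def, ← integral_sub (hex x) (hex y)]
    refine (norm_integral_le_of_norm_le (g := fun t => ρ.normed volume t * (K * dist x y))
      (ρ.integrable_normed.mul_const _) (Filter.Eventually.of_forall fun t => ?_)).trans ?_
    · simp only [lsmul_apply, smul_eq_mul, ← mul_sub, norm_mul]
      rw [Real.norm_of_nonneg (ρ.nonneg_normed t), ← dist_eq_norm]
      refine mul_le_mul_of_nonneg_left ?_ (ρ.nonneg_normed t)
      simpa using hf.dist_le_mul (x - t) (y - t)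
    · rw [integral_mul_const, ρ.integral_normed, one_mul]
  refine ⟨_, hsmooth, fun x => ?_, fun x => ?_, fun x hx => ?_⟩
  · rw [norm_gradient]
    exact norm_fderiv_le_of_lipschitz ℝ hlip
  · rw [← Real.dist_eq]
    refine ρ.dist_normed_convolution_le hfc.aestronglyMeasurable fun y hy => ?_
    exact (hf.dist_le_mul y x).trans (mul_le_mul_of_nonneg_left (mem_ball.1 hy).le K.2)
  · exact ρ.normed_convolution_eq_right hx

section approx

variable {F : Type*} [NormedAddCommGroup F] {u : Eucl d → F}

theorem exists_eLpNorm_translate_sub_le (hu : MemLp u 2 volume) {ε : ℝ} (hε : 0 < ε) :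
    ∃ δ > 0, ∀ y ∈ ball (0 : Eucl d) δ, eLpNorm (fun x => u (x - y) - u x) 2 volume ≤ ENNReal.ofReal ε := by
  let T (y : Eucl d) : C(Eucl d, Eucl d) := ⟨fun x => x - y, by fun_prop⟩
  have hT : Continuous T := ContinuousMap.continuous_of_continuous_uncurry _ (by
    change Continuous fun p : Eucl d × Eucl d => p.2 - p.1
    fun_prop)
  have hTm (y) : MeasurePreserving (T y) volume volume := measurePreserving_sub_right volume y
  have hc : Continuous fun y => Lp.compMeasurePreserving (T y) (hTm y) (hu.toLp u) :=
    continuous_const.compMeasurePreservingLp hT hTm (by simp)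
  obtain ⟨δ, hδ, h⟩ := Metric.tendsto_nhds_nhds.1 (hc.tendsto 0) ε hε
  refine ⟨δ, hδ, fun y hy => ?_⟩
  have h0 : Lp.compMeasurePreserving (T 0) (hTm 0) (hu.toLp u) = hu.toLp u := by
    rw [Lp.toLp_compMeasurePreserving hu (hTm 0)]
    congr 1
    funext x
    exact congrArg u (sub_zero x)
  have hy' := h hy
  rw [h0, Lp.toLp_compMeasurePreserving hu (hTm y), dist_eq_norm, ← MemLp.toLp_sub,
    Lp.norm_toLp] at hy'
  exact ((ENNReal.lt_ofReal_iff_toReal_lt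
    ((hu.comp_measurePreserving (hTm y)).sub hu).eLpNorm_ne_top).2 hy').le

variable [NormedSpace ℝ F] [CompleteSpace F]

theorem eLpNorm_mollify_sub_le (hu : MemLp u 2 volume) (ρ : ContDiffBump (0 : Eucl d)) {ε : ℝ≥0∞}
    (h : ∀ y ∈ ball (0 : Eucl d) ρ.rOut,
      eLpNorm (fun x => u (x - y) - u x) 2 volume ≤ ε) :
    eLpNorm (fun x => (ρ.normed volume ⋆[lsmul ℝ ℝ, volume] u) x - u x) 2 volume ≤ ε := by
  set r : Eucl d → ℝ := ρ.normed volume with hr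
  have hloc : LocallyIntegrable u volume := hu.locallyIntegrable (by norm_num)
  have hrc : Continuous r := (ρ.contDiff_normed (n := 0)).continuous
  have hex : ConvolutionExists r u (lsmul ℝ ℝ) volume :=
    ρ.hasCompactSupport_normed.convolutionExists_left _ hrc hloc
  let ν : Measure (Eucl d) := volume.withDensity fun y => ENNReal.ofReal (r y)
  have hν : IsProbabilityMeasure ν := ⟨by
    rw [withDensity_apply _ MeasurableSet.univ, Measure.restrict_univ,
      ← ofReal_integral_eq_lintegral_ofReal ρ.integrable_normed
        (Filter.Eventually.of_forall ρ.nonneg_normed), ρ.integral_normed, ENNReal.ofReal_one]⟩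
  have hdiff : AEStronglyMeasurable (fun p : Eucl d × Eucl d => u (p.1 - p.2) - u p.1)
      (volume.prod ν) :=
    (hu.1.comp_quasiMeasurePreserving
      (quasiMeasurePreserving_sub_of_right_invariant volume ν)).sub hu.1.comp_fst
  have hrep (x : Eucl d) : (r ⋆[lsmul ℝ ℝ, volume] u) x - u x = ∫ y, (u (x - y) - u x) ∂ν := by
    have e1 : ∫ y, (u (x - y) - u x) ∂ν = ∫ y, r y • (u (x - y) - u x) := by
      rw [integral_withDensity_eq_integral_toReal_smul (by fun_prop) (by simp)]
      refine integral_congr_ae (Filter.Eventually.of_forall fun y => ?_)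
      change (ENNReal.ofReal (r y)).toReal • _ = _
      rw [ENNReal.toReal_ofReal (ρ.nonneg_normed y)]
    simp only [e1, smul_sub]
    have e2 : ∫ y, r y • u x = u x := by
      rw [integral_smul_const, ρ.integral_normed, one_smul]
    have hi : Integrable (fun y => r y • u (x - y)) := hex x
    rw [integral_sub hi (ρ.integrable_normed.smul_const _), e2]
    rfl
  have hjen : ∀ᵐ x : Eucl d, ‖∫ y, (u (x - y) - u x) ∂ν‖ₑ ^ (2 : ℝ)
      ≤ ∫⁻ y, ‖u (x - y) - u x‖ₑ ^ (2 : ℝ) ∂ν := by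
    filter_upwards [hdiff.prodMk_left] with x hx
    have := (enorm_integral_le_lintegral_enorm (fun y => u (x - y) - u x) (μ := ν)).trans
      ((eLpNorm_one_eq_lintegral_enorm (μ := ν)).symm.le.trans
        (eLpNorm_le_eLpNorm_of_exponent_le (p := 1) (q := 2) (by norm_num) hx))
    rw [eLpNorm_eq_lintegral_rpow_enorm_toReal (by norm_num) (by norm_num)] at this
    refine (ENNReal.rpow_le_rpow this (by norm_num)).trans ?_
    rw [← ENNReal.rpow_mul]
    simp
  rw [eLpNorm_eq_lintegral_rpow_enorm_toReal (by norm_num) (by norm_num)]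
  simp only [ENNReal.toReal_ofNat, one_div]
  rw [ENNReal.rpow_inv_le_iff (by norm_num)]
  simp only [hrep]
  refine (lintegral_mono_ae hjen).trans ?_
  rw [lintegral_lintegral_swap (hdiff.enorm.pow_const _)]
  have hpt : ∀ᵐ y ∂ν, ∫⁻ x, ‖u (x - y) - u x‖ₑ ^ (2 : ℝ) ≤ ε ^ (2 : ℝ) := by
    refine (ae_withDensity_iff (by fun_prop)).2 (Filter.Eventually.of_forall fun y hy => ?_)
    have hy' : y ∈ ball (0 : Eucl d) ρ.rOut := by
      rw [← ρ.support_normed_eq (μ := volume)]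
      intro h0
      exact hy (by simp [hr, h0])
    have := h y hy'
    rw [eLpNorm_eq_lintegral_rpow_enorm_toReal (by norm_num) (by norm_num)] at this
    simp only [ENNReal.toReal_ofNat, one_div] at this
    rwa [ENNReal.rpow_inv_le_iff (by norm_num)] at this
  refine (lintegral_mono_ae hpt).trans ?_
  simp

end approx

theorem l2Norm_eq_norm {F : Type*} [NormedAddCommGroup F] {U : Set (Eucl d)} {f : Eucl d → F}
    (hf : MemLp f 2 (volume.restrict U)) : l2Norm U f = ‖hf.toLp f‖ :=
  (Lp.norm_toLp f hf).symm

theorem l2Norm_nonneg {F : Type*} [NormedAddCommGroup F] (U : Set (Eucl d)) (f : Eucl d → F) :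
    0 ≤ l2Norm U f :=
  ENNReal.toReal_nonneg

theorem abs_integral_mul_le {U : Set (Eucl d)} {u v : Eucl d → ℝ}
    (hu : MemLp u 2 (volume.restrict U)) (hv : MemLp v 2 (volume.restrict U)) :
    |∫ x in U, u x * v x| ≤ l2Norm U u * l2Norm U v := by
  rw [integral_mul_eq hu hv, l2Norm_eq_norm hu, l2Norm_eq_norm hv]
  exact abs_real_inner_le_norm _ _

theorem abs_integral_inner_le {U : Set (Eucl d)} {u v : Eucl d → Eucl d}
    (hu : MemLp u 2 (volume.restrict U)) (hv : MemLp v 2 (volume.restrict U)) :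
    |∫ x in U, ⟪u x, v x⟫| ≤ l2Norm U u * l2Norm U v := by
  rw [integral_inner_eq hu hv, l2Norm_eq_norm hu, l2Norm_eq_norm hv]
  exact abs_real_inner_le_norm _ _

theorem integrable_mul_of_memLp {μ : Measure (Eucl d)} {u v : Eucl d → ℝ}
    (hu : MemLp u 2 μ) (hv : MemLp v 2 μ) :
    Integrable (fun x => u x * v x) μ :=
  hu.integrable_mul hv

theorem integrable_inner_of_memLp {μ : Measure (Eucl d)} {u v : Eucl d → Eucl d}
    (hu : MemLp u 2 μ) (hv : MemLp v 2 μ) :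
    Integrable (fun x => ⟪u x, v x⟫) μ := by
  refine (integrable_mul_of_memLp hu.norm hv.norm).mono' (hu.1.inner hv.1) ?_
  exact Filter.Eventually.of_forall fun x => norm_inner_le_norm _ _

theorem IsTest.continuous_fderiv_apply {U : Set (Eucl d)} {φ : Eucl d → ℝ} (h : IsTest U φ)
    (e : Eucl d) : Continuous fun x => fderiv ℝ φ x e :=
  (h.1.continuous_fderiv (by simp)).clm_apply continuous_const

theorem IsTest.integral_mul_fderiv {U : Set (Eucl d)} {φ ψ : Eucl d → ℝ} (hφ : IsTest U φ)
    (hψ : IsTest univ ψ) (e : Eucl d) :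
    ∫ x in U, φ x * fderiv ℝ ψ x e = -∫ x in U, ⟪∇ φ x, e⟫ * ψ x := by
  have h0 : ∀ x, x ∉ U → φ x = 0 := fun x hx => image_eq_zero_of_notMem_tsupport fun h => hx (hφ.2.2 h)
  have h1 : ∀ x, x ∉ U → fderiv ℝ φ x = 0 := fun x hx =>
    image_eq_zero_of_notMem_tsupport fun h => hx (hφ.2.2 (tsupport_fderiv_subset ℝ h))
  rw [setIntegral_eq_integral_of_forall_compl_eq_zero (fun x hx => by rw [h0 x hx, zero_mul]),
    setIntegral_eq_integral_of_forall_compl_eq_zero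
      (fun x hx => by rw [inner_gradient, h1 x hx]; simp)]
  simp only [inner_gradient]
  refine integral_mul_fderiv_eq_neg_fderiv_mul_of_integrable ?_ ?_ ?_
    (fun x _ => hφ.1.differentiable (by simp) x) (fun x _ => hψ.1.differentiable (by simp) x)
  · exact ((hφ.continuous_fderiv_apply e).mul hψ.1.continuous).integrable_of_hasCompactSupport
      hψ.2.1.mul_left
  · exact (hφ.1.continuous.mul (hψ.continuous_fderiv_apply e)).integrable_of_hasCompactSupport
      hφ.2.1.mul_right
  · exact (hφ.1.continuous.mul hψ.1.continuous).integrable_of_hasCompactSupport hφ.2.1.mul_right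

theorem MemH10.memH1_indicator {U : Set (Eucl d)} (hU : MeasurableSet U) {u : Eucl d → ℝ}
    {g : Eucl d → Eucl d} (h : MemH10 U u g) : MemH1 univ (U.indicator u) (U.indicator g) := by
  obtain ⟨hu, hg, happ⟩ := h
  refine ⟨?_, ?_, fun ψ hψ e => ?_⟩
  · rwa [Measure.restrict_univ, memLp_indicator_iff_restrict hU]
  · rwa [Measure.restrict_univ, memLp_indicator_iff_restrict hU]
  have e1 : ∫ x in univ, U.indicator u x * fderiv ℝ ψ x e = ∫ x in U, u x * fderiv ℝ ψ x e := by
    rw [Measure.restrict_univ, ← integral_indicator hU]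
    exact integral_congr_ae (Filter.Eventually.of_forall fun x => by
      by_cases hx : x ∈ U <;> simp [hx])
  have e2 : ∫ x in univ, ⟪U.indicator g x, e⟫ * ψ x = ∫ x in U, ⟪g x, ψ x • e⟫ := by
    rw [Measure.restrict_univ, ← integral_indicator hU]
    exact integral_congr_ae (Filter.Eventually.of_forall fun x => by
      by_cases hx : x ∈ U <;> simp [hx, inner_smul_right, mul_comm])
  have hψ1 : MemLp (fun x => fderiv ℝ ψ x e) 2 (volume.restrict U) := by
    simpa using (hψ.memLp_fderiv e).restrict U
  have hψ2 : MemLp (fun x => ψ x • e) 2 (volume.restrict U) := by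
    simpa using (hψ.memLp_smul e).restrict U
  rw [e1, e2, eq_neg_iff_add_eq_zero]
  set A := l2Norm U (fun x => fderiv ℝ ψ x e) + l2Norm U (fun x => ψ x • e) with hA
  have hA0 : 0 ≤ A := add_nonneg (l2Norm_nonneg _ _) (l2Norm_nonneg _ _)
  have key : ∀ ε : ℝ, 0 < ε →
      |(∫ x in U, u x * fderiv ℝ ψ x e) + ∫ x in U, ⟪g x, ψ x • e⟫| ≤ ε * A := by
    intro ε hε
    obtain ⟨φ, hφ, hφ1, hφ2⟩ := happ ε hε
    have hd1 : MemLp (fun x => u x - φ x) 2 (volume.restrict U) := hu.sub hφ.memLp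
    have hd2 : MemLp (fun x => g x - ∇ φ x) 2 (volume.restrict U) := hg.sub hφ.memLp_gradient
    have i1 : ∫ x in U, (u x - φ x) * fderiv ℝ ψ x e
        = (∫ x in U, u x * fderiv ℝ ψ x e) - ∫ x in U, φ x * fderiv ℝ ψ x e := by
      simp only [sub_mul]
      exact integral_sub (integrable_mul_of_memLp hu hψ1) (integrable_mul_of_memLp hφ.memLp hψ1)
    have i2 : ∫ x in U, ⟪g x - ∇ φ x, ψ x • e⟫
        = (∫ x in U, ⟪g x, ψ x • e⟫) - ∫ x in U, ⟪∇ φ x, ψ x • e⟫ := by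
      simp only [inner_sub_left]
      exact integral_sub (integrable_inner_of_memLp hg hψ2)
        (integrable_inner_of_memLp hφ.memLp_gradient hψ2)
    have i3 := hφ.integral_mul_fderiv hψ e
    have i4 : ∫ x in U, ⟪∇ φ x, e⟫ * ψ x = ∫ x in U, ⟪∇ φ x, ψ x • e⟫ := by
      simp only [inner_smul_right, mul_comm]
    rw [i4] at i3
    have b1 := abs_integral_mul_le hd1 hψ1
    have b2 := abs_integral_inner_le hd2 hψ2
    have l1 : l2Norm U (fun x => u x - φ x) ≤ ε :=
      ((ENNReal.lt_ofReal_iff_toReal_lt hd1.eLpNorm_ne_top).1 hφ1).le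
    have l2 : l2Norm U (fun x => g x - ∇ φ x) ≤ ε :=
      ((ENNReal.lt_ofReal_iff_toReal_lt hd2.eLpNorm_ne_top).1 hφ2).le
    have m1 := mul_le_mul_of_nonneg_right l1 (l2Norm_nonneg U (fun x => fderiv ℝ ψ x e))
    have m2 := mul_le_mul_of_nonneg_right l2 (l2Norm_nonneg U (fun x => ψ x • e))
    have hsum : (∫ x in U, u x * fderiv ℝ ψ x e) + ∫ x in U, ⟪g x, ψ x • e⟫
        = (∫ x in U, (u x - φ x) * fderiv ℝ ψ x e) + ∫ x in U, ⟪g x - ∇ φ x, ψ x • e⟫ := by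
      rw [i1, i2]; linarith
    rw [hsum, hA, mul_add]
    exact (abs_add_le _ _).trans (add_le_add (b1.trans m1) (b2.trans m2))
  by_contra hne
  have hpos := abs_pos.2 hne
  have := key (|(∫ x in U, u x * fderiv ℝ ψ x e) + ∫ x in U, ⟪g x, ψ x • e⟫| / (2 * (A + 1)))
    (by positivity)
  rw [div_mul_eq_mul_div, le_div_iff₀ (by positivity)] at this
  nlinarith

theorem memLp_bounded_smul {F : Type*} [NormedAddCommGroup F] [NormedSpace ℝ F]
    {μ : Measure (Eucl d)} {f : Eucl d → F}
    (hf : MemLp f 2 μ) {w : Eucl d → ℝ} (hw : Continuous w) {A : ℝ} (hA : ∀ x, |w x| ≤ A) :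
    MemLp (fun x => w x • f x) 2 μ :=
  hf.of_le_mul (c := A) (hw.aestronglyMeasurable.smul hf.1) (Filter.Eventually.of_forall fun x => by
    rw [norm_smul]
    exact mul_le_mul_of_nonneg_right (hA x) (norm_nonneg _))

theorem continuous_gradient {w : Eucl d → ℝ} (hw : ContDiff ℝ ∞ w) : Continuous (∇ w) :=
  (InnerProductSpace.toDual ℝ (Eucl d)).symm.continuous.comp (hw.continuous_fderiv (by simp))

theorem MemH1.mul_smooth {u : Eucl d → ℝ} {g : Eucl d → Eucl d} (h : MemH1 univ u g)
    {w : Eucl d → ℝ} (hw : ContDiff ℝ ∞ w) {A B : ℝ} (hA : ∀ x, |w x| ≤ A)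
    (hB : ∀ x, ‖∇ w x‖ ≤ B) :
    MemH1 univ (fun x => w x * u x) (fun x => w x • g x + u x • ∇ w x) := by
  obtain ⟨hu, hg, hibp⟩ := h
  have hug : MemLp (fun x => u x • ∇ w x) 2 (volume.restrict univ) :=
    hu.of_le_mul (c := B) (hu.1.smul (continuous_gradient hw).aestronglyMeasurable)
      (Filter.Eventually.of_forall fun x => by
        rw [norm_smul, mul_comm]
        exact mul_le_mul_of_nonneg_right (hB x) (norm_nonneg _))
  refine ⟨memLp_bounded_smul hu hw.continuous hA, (memLp_bounded_smul hg hw.continuous hA).add hug,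
    fun φ hφ e => ?_⟩
  have hwφ : IsTest univ (fun x => w x * φ x) :=
    ⟨hw.mul hφ.1, hφ.2.1.mul_left, subset_univ _⟩
  have h1 := hibp _ hwφ e
  have hfd (x : Eucl d) : fderiv ℝ (fun x => w x * φ x) x e
      = w x * fderiv ℝ φ x e + φ x * ⟪∇ w x, e⟫ := by
    rw [inner_gradient, fderiv_fun_mul (hw.differentiable (by simp) x)
      (hφ.1.differentiable (by simp) x)]
    simp
  have m1 : MemLp (fun x => w x * fderiv ℝ φ x e) 2 (volume.restrict univ) :=
    memLp_bounded_smul (hφ.memLp_fderiv e) hw.continuous hA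
  have m2 : MemLp (fun x => φ x * ⟪∇ w x, e⟫) 2 (volume.restrict univ) :=
    (hφ.1.continuous.mul ((continuous_gradient hw).inner continuous_const)).memLp_of_hasCompactSupport
      hφ.2.1.mul_right
  have m3 : MemLp (fun x => (w x * φ x) • e) 2 (volume.restrict univ) := hwφ.memLp_smul e
  have m4 : MemLp (fun x => φ x • e) 2 (volume.restrict univ) := hφ.memLp_smul e
  have s1 : ∫ x in univ, u x * fderiv ℝ (fun x => w x * φ x) x e
      = (∫ x in univ, u x * (w x * fderiv ℝ φ x e)) + ∫ x in univ, u x * (φ x * ⟪∇ w x, e⟫) := by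
    rw [← integral_add (integrable_mul_of_memLp hu m1) (integrable_mul_of_memLp hu m2)]
    simp only [hfd, mul_add]
  have i1 : Integrable (fun x => ⟪g x, e⟫ * (w x * φ x)) (volume.restrict univ) := by
    refine (integrable_inner_of_memLp hg m3).congr (Filter.Eventually.of_forall fun x => ?_)
    simp only [inner_smul_right]; ring
  have s2 : ∫ x in univ, ⟪w x • g x + u x • ∇ w x, e⟫ * φ x
      = (∫ x in univ, ⟪g x, e⟫ * (w x * φ x)) + ∫ x in univ, u x * (φ x * ⟪∇ w x, e⟫) := by
    rw [← integral_add i1 (integrable_mul_of_memLp hu m2)]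
    refine integral_congr_ae (Filter.Eventually.of_forall fun x => ?_)
    simp only [inner_add_left, real_inner_smul_left]; ring
  have s3 : ∫ x in univ, w x * u x * fderiv ℝ φ x e
      = ∫ x in univ, u x * (w x * fderiv ℝ φ x e) :=
    integral_congr_ae (Filter.Eventually.of_forall fun x => by ring)
  rw [s2, s3]
  linarith

theorem fderiv_convolution_apply {r u : Eucl d → ℝ} (hrs : ContDiff ℝ ∞ r)
    (hrc : HasCompactSupport r) (hu : LocallyIntegrable u volume) (x e : Eucl d) :
    fderiv ℝ (r ⋆[lsmul ℝ ℝ, volume] u) x e = ∫ t, u t * fderiv ℝ r (x - t) e := by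
  have hfd := hrc.hasFDerivAt_convolution_left (lsmul ℝ ℝ) (hrs.of_le (by simp)) hu x (μ := volume)
  have hex : Integrable
      (fun t => (precompL (Eucl d) (lsmul ℝ ℝ : ℝ →L[ℝ] ℝ →L[ℝ] ℝ)) (fderiv ℝ r (x - t)) (u t)) :=
    ConvolutionExistsAt.integrable_swap
      ((hrc.fderiv ℝ).convolutionExists_left ((lsmul ℝ ℝ : ℝ →L[ℝ] ℝ →L[ℝ] ℝ).precompL (Eucl d))
        (hrs.continuous_fderiv (by simp)) hu x)
  rw [hfd.fderiv, convolution_eq_swap, ContinuousLinearMap.integral_apply hex]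
  refine integral_congr_ae (Filter.Eventually.of_forall fun t => ?_)
  exact mul_comm _ _

theorem MemH1.gradient_mollify {u : Eucl d → ℝ} {g : Eucl d → Eucl d} (h : MemH1 univ u g)
    (ρ : ContDiffBump (0 : Eucl d)) (x : Eucl d) :
    ∇ (ρ.normed volume ⋆[lsmul ℝ ℝ, volume] u) x
      = (ρ.normed volume ⋆[lsmul ℝ ℝ, volume] g) x := by
  obtain ⟨hu, hg, hibp⟩ := h
  rw [Measure.restrict_univ] at hu hg
  set r : Eucl d → ℝ := ρ.normed volume with hr
  have hrs : ContDiff ℝ ∞ r := ρ.contDiff_normed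
  have hrc : HasCompactSupport r := ρ.hasCompactSupport_normed
  have hul : LocallyIntegrable u volume := hu.locallyIntegrable (by norm_num)
  have hgl : LocallyIntegrable g volume := hg.locallyIntegrable (by norm_num)
  refine ext_inner_right ℝ fun e => ?_
  rw [inner_gradient, fderiv_convolution_apply hrs hrc hul, convolution_eq_swap]
  have hex2 : Integrable (fun t => lsmul ℝ ℝ (r (x - t)) (g t)) :=
    (hrc.convolutionExists_left (lsmul ℝ ℝ) hrs.continuous hgl x).integrable_swap
  rw [real_inner_comm, ← integral_inner hex2]
  have htest : IsTest univ (fun t => r (x - t)) :=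
    ⟨hrs.comp (contDiff_const.sub contDiff_id),
      hrc.comp_homeomorph (Homeomorph.subLeft x), subset_univ _⟩
  have h1 := hibp _ htest e
  rw [Measure.restrict_univ] at h1
  have hfd (t : Eucl d) : fderiv ℝ (fun t => r (x - t)) t e = -fderiv ℝ r (x - t) e := by
    have : HasFDerivAt (fun t => r (x - t)) ((fderiv ℝ r (x - t)).comp (-ContinuousLinearMap.id ℝ (Eucl d))) t :=
      HasFDerivAt.comp t (hrs.differentiable (by simp) (x - t)).hasFDerivAt
        ((hasFDerivAt_id t).const_sub x)
    rw [this.fderiv]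
    simp
  simp only [hfd, mul_neg, integral_neg, neg_inj] at h1
  rw [h1]
  refine integral_congr_ae (Filter.Eventually.of_forall fun t => ?_)
  simp [inner_smul_right, real_inner_comm, mul_comm]

theorem MemH1.memH10_of_compact {u : Eucl d → ℝ} {g : Eucl d → Eucl d} (h : MemH1 univ u g)
    {U K : Set (Eucl d)} (hU : IsOpen U) (hK : IsCompact K) (hKU : K ⊆ U)
    (h0 : ∀ x, x ∉ K → u x = 0) : MemH10 U u g := by
  have hu : MemLp u 2 volume := by simpa using h.1
  have hg : MemLp g 2 volume := by simpa using h.2.1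
  refine ⟨hu.restrict U, hg.restrict U, fun ε hε => ?_⟩
  obtain ⟨δ₀, hδ₀, hδU⟩ := hK.exists_cthickening_subset_open hU hKU
  obtain ⟨δ₁, hδ₁, h1⟩ := exists_eLpNorm_translate_sub_le hu (half_pos hε)
  obtain ⟨δ₂, hδ₂, h2⟩ := exists_eLpNorm_translate_sub_le hg (half_pos hε)
  have hδ : 0 < min δ₀ (min δ₁ δ₂) := lt_min hδ₀ (lt_min hδ₁ hδ₂)
  let ρ : ContDiffBump (0 : Eucl d) := originBump hδ
  have b1 : ball (0 : Eucl d) ρ.rOut ⊆ ball 0 δ₁ :=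
    ball_subset_ball ((min_le_right _ _).trans (min_le_left _ _))
  have b2 : ball (0 : Eucl d) ρ.rOut ⊆ ball 0 δ₂ :=
    ball_subset_ball ((min_le_right _ _).trans (min_le_right _ _))
  have c1 := eLpNorm_mollify_sub_le hu ρ fun y hy => h1 y (b1 hy)
  have c2 := eLpNorm_mollify_sub_le hg ρ fun y hy => h2 y (b2 hy)
  have hlt : ENNReal.ofReal (ε / 2) < ENNReal.ofReal ε :=
    (ENNReal.ofReal_lt_ofReal_iff hε).2 (half_lt_self hε)
  have hsub : tsupport (ρ.normed volume ⋆[lsmul ℝ ℝ, volume] u) ⊆ cthickening δ₀ K := by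
    refine closure_minimal ?_ isClosed_cthickening
    refine (support_convolution_subset (lsmul ℝ ℝ)).trans ?_
    rintro _ ⟨a, ha, b, hb, rfl⟩
    rw [ρ.support_normed_eq] at ha
    have hbK : b ∈ K := by_contra fun hb' => hb (h0 b hb')
    refine mem_cthickening_of_dist_le (a + b) b δ₀ K hbK ?_
    rw [dist_eq_norm, add_sub_cancel_right]
    exact (mem_ball_zero_iff.1 ha).le.trans (min_le_left _ _)
  refine ⟨ρ.normed volume ⋆[lsmul ℝ ℝ, volume] u, ⟨?_, ?_, hsub.trans hδU⟩, ?_, ?_⟩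
  · exact ρ.hasCompactSupport_normed.contDiff_convolution_left _ ρ.contDiff_normed
      (hu.locallyIntegrable (by norm_num))
  · exact hK.cthickening.of_isClosed_subset isClosed_closure hsub
  · refine lt_of_le_of_lt (eLpNorm_restrict_le _ _ _ _) (lt_of_le_of_lt ?_ hlt)
    rw [← eLpNorm_neg]
    refine (le_of_eq ?_).trans c1
    congr 1
    funext x
    simp
  · refine lt_of_le_of_lt (eLpNorm_restrict_le _ _ _ _) (lt_of_le_of_lt ?_ hlt)
    rw [← eLpNorm_neg]
    refine (le_of_eq ?_).trans c2
    congr 1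
    funext x
    simp [h.gradient_mollify ρ x]

theorem dilatedDomain_eq (Ω : Set (Eucl d)) (M t : ℝ) :
    dilatedDomain Ω M t = (1 + max 1 t * (1 + M)) • Ω := by
  unfold dilatedDomain
  split_ifs with h
  · rw [max_eq_right h]
  · rw [max_eq_left (not_le.1 h).le]
    congr 1
    ring

section domain

variable {Ω : Set (Eucl d)} {M : ℝ} (t : ℝ)

theorem one_lt_dilation (hM : 0 < M) : 1 < 1 + max 1 t * (1 + M) := by
  have : 0 < max 1 t := lt_max_of_lt_left one_pos
  have : 0 < max 1 t * (1 + M) := by positivity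
  linarith

theorem isOpen_dilatedDomain (hΩ : IsOpen Ω) (hM : 0 < M) : IsOpen (dilatedDomain Ω M t) := by
  rw [dilatedDomain_eq]
  exact hΩ.smul₀ (one_pos.trans (one_lt_dilation t hM)).ne'

theorem isBounded_dilatedDomain (hΩ : Bornology.IsBounded Ω) :
    Bornology.IsBounded (dilatedDomain Ω M t) := by
  rw [dilatedDomain_eq]
  exact hΩ.smul₀ _

theorem dilatedDomain_eq_add (hΩ : Convex ℝ Ω) (hM : 0 < M) :
    dilatedDomain Ω M t = Ω + (max 1 t * (1 + M)) • Ω := by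
  have h0 : 0 ≤ max 1 t * (1 + M) := by linarith [one_lt_dilation t hM]
  rw [dilatedDomain_eq, hΩ.add_smul zero_le_one h0, one_smul]

theorem subset_dilatedDomain (hΩ : Convex ℝ Ω) (h0 : (0 : Eucl d) ∈ Ω) (hM : 0 < M) :
    Ω ⊆ dilatedDomain Ω M t := by
  intro x hx
  rw [dilatedDomain_eq_add t hΩ hM]
  exact ⟨x, hx, 0, ⟨0, h0, smul_zero _⟩, add_zero x⟩

theorem measurableSet_boundaryLayer (hΩ : IsOpen Ω) (hM : 0 < M) :
    MeasurableSet (boundaryLayer Ω M t) :=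
  ((isOpen_dilatedDomain t hΩ hM).inter
    (isOpen_lt (continuous_infDist_pt _) continuous_const)).measurableSet

theorem ne_univ_of_isBounded (hd : 1 ≤ d) {U : Set (Eucl d)} (hU : Bornology.IsBounded U) :
    U ≠ univ := by
  rintro rfl
  have : Nonempty (Fin d) := ⟨⟨0, hd⟩⟩
  exact NormedSpace.unbounded_univ ℝ (Eucl d) hU

theorem dist_boundaryLayer_ge (hd : 1 ≤ d) (hΩo : IsOpen Ω) (hΩ : Convex ℝ Ω)
    (hΩb : Bornology.IsBounded Ω) (hM : 0 < M) {r : ℝ} (hr : ball (0 : Eucl d) r ⊆ Ω)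
    {x z : Eucl d} (hx : x ∈ boundaryLayer Ω M t) (hz : z ∈ Ω) :
    max 1 t * (1 + M) * r - t ≤ dist x z := by
  obtain ⟨hxU, hxt⟩ := hx
  have hne : (frontier (dilatedDomain Ω M t)).Nonempty := by
    rw [nonempty_frontier_iff]
    exact ⟨⟨x, hxU⟩, ne_univ_of_isBounded hd (isBounded_dilatedDomain t hΩb)⟩
  obtain ⟨y, hy, hxy⟩ := (infDist_lt_iff hne).1 hxt
  have hyU : y ∉ dilatedDomain Ω M t := by
    rw [(isOpen_dilatedDomain t hΩo hM).frontier_eq] at hy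
    exact hy.2
  have hm : 0 < max 1 t * (1 + M) := by linarith [one_lt_dilation t hM]
  have hyz : max 1 t * (1 + M) * r ≤ dist y z := by
    by_contra! hlt
    refine hyU ?_
    rw [dilatedDomain_eq_add t hΩ hM]
    refine ⟨z, hz, y - z, ⟨(max 1 t * (1 + M))⁻¹ • (y - z), hr ?_, ?_⟩, add_sub_cancel z y⟩
    · rw [mem_ball_zero_iff, norm_smul, norm_inv, Real.norm_of_nonneg hm.le, inv_mul_lt_iff₀ hm,
        ← dist_eq_norm]
      exact hlt
    · exact smul_inv_smul₀ hm.ne' _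
  have := dist_triangle y x z
  rw [dist_comm y x] at this
  linarith

end domain

theorem l2Norm_sq_real {U : Set (Eucl d)} {f : Eucl d → ℝ} (hf : MemLp f 2 (volume.restrict U)) :
    l2Norm U f ^ 2 = ∫ x in U, f x * f x := by
  rw [integral_mul_eq hf hf, real_inner_self_eq_norm_sq, l2Norm_eq_norm hf]

theorem l2Norm_sq_vector {U : Set (Eucl d)} {f : Eucl d → Eucl d}
    (hf : MemLp f 2 (volume.restrict U)) : l2Norm U f ^ 2 = ∫ x in U, ⟪f x, f x⟫ := by
  rw [integral_inner_eq hf hf, real_inner_self_eq_norm_sq, l2Norm_eq_norm hf]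

theorem l2Norm_zeroExt {D : Set (Eucl d)} (hD : MeasurableSet D) (η : Eucl d → ℝ) :
    l2Norm univ (zeroExt D η) = l2Norm D η := by
  rw [l2Norm, Measure.restrict_univ, eLpNorm_indicator_eq_eLpNorm_restrict hD, l2Norm]

theorem weighted_pointwise {w t a v ψ : ℝ} {g h : Eucl d} (hw : 0 < w) (ht : 0 < t)
    (hh : ‖h‖ ≤ w / t) (ha : ψ ≠ 0 → w ≤ a) :
    w * (v * v) + t ^ 2 * (w * ⟪g, g⟫)
      ≤ 4 * (v * (w * v) + t ^ 2 * ⟪g, w • g + v • h⟫ + ψ * (w * v)) + 4 * a * (ψ * ψ) := by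
  rw [inner_add_right, real_inner_smul_right, real_inner_smul_right, real_inner_self_eq_norm_sq]
  have h1 : |v * ⟪g, h⟫| ≤ |v| * (‖g‖ * (w / t)) := by
    rw [abs_mul]
    exact mul_le_mul_of_nonneg_left ((abs_real_inner_le_norm g h).trans
      (mul_le_mul_of_nonneg_left hh (norm_nonneg _))) (abs_nonneg _)
  have h2 : -(|v| * (‖g‖ * (w / t))) ≤ v * ⟪g, h⟫ := (abs_le.1 h1).1
  have h3 := mul_le_mul_of_nonneg_left h2 (sq_nonneg t)
  have h4 : t ^ 2 * -(|v| * (‖g‖ * (w / t))) = -(w * (|v| * (t * ‖g‖))) := by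
    field_simp
  rw [h4] at h3
  have h5 : |v| * (t * ‖g‖) ≤ (v * v + t ^ 2 * ‖g‖ ^ 2) / 2 := by
    nlinarith [sq_nonneg (|v| - t * ‖g‖), abs_mul_abs_self v]
  have h6 := mul_le_mul_of_nonneg_left h5 hw.le
  have h7 : 0 ≤ w * (t ^ 2 * ‖g‖ ^ 2) := by positivity
  have h8 : w * (ψ * ψ) ≤ a * (ψ * ψ) := by
    by_cases hψ : ψ = 0
    · simp [hψ]
    · exact mul_le_mul_of_nonneg_right (ha hψ) (mul_self_nonneg ψ)
  have h9 : 0 ≤ w * ((v / 2 + ψ) * (v / 2 + ψ)) := mul_nonneg hw.le (mul_self_nonneg _)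
  nlinarith

theorem IsWholeSol.weighted_estimate {t : ℝ} (ht : 0 < t) {ψ v : Eucl d → ℝ}
    {g : Eucl d → Eucl d} (hψ : MemLp ψ 2 (volume.restrict univ)) (h : IsWholeSol t ψ v g)
    {w : Eucl d → ℝ} (hw : ContDiff ℝ ∞ w) (hw0 : ∀ x, 0 < w x) {A : ℝ} (hA : ∀ x, w x ≤ A)
    (hw' : ∀ x, ‖∇ w x‖ ≤ w x / t) {a b : ℝ} (ha : ∀ x, ψ x ≠ 0 → w x ≤ a) {B : Set (Eucl d)}
    (hB : MeasurableSet B) (hb : ∀ x ∈ B, b ≤ w x) :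
    b * (l2Norm B v ^ 2 + t ^ 2 * l2Norm B g ^ 2) ≤ 4 * a * l2Norm univ ψ ^ 2 := by
  have hA' : ∀ x, |w x| ≤ A := fun x => by rw [abs_of_pos (hw0 x)]; exact hA x
  have htest := h.1.mul_smooth hw hA' (B := A / t)
    fun x => (hw' x).trans (div_le_div_of_nonneg_right (hA x) ht.le)
  have hE := h.2 _ _ htest
  obtain ⟨⟨hv, hg, -⟩, -⟩ := h
  have hwv : MemLp (fun x => w x * v x) 2 (volume.restrict univ) := htest.1
  have hwg : MemLp (fun x => w x • g x) 2 (volume.restrict univ) :=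
    memLp_bounded_smul hg hw.continuous hA'
  have i1 := integrable_mul_of_memLp hv hwv
  have i2 := integrable_inner_of_memLp hg htest.2.1
  have i3 := integrable_mul_of_memLp hψ hwv
  have i4 := integrable_mul_of_memLp hψ hψ
  have i5 : Integrable (fun x => w x * (v x * v x)) (volume.restrict univ) :=
    i1.congr (Filter.Eventually.of_forall fun x => by ring)
  have i6 : Integrable (fun x => w x * ⟪g x, g x⟫) (volume.restrict univ) :=
    (integrable_inner_of_memLp hg hwg).congr
      (Filter.Eventually.of_forall fun x => real_inner_smul_right _ _ _)
  have i7 : Integrable (fun x => w x * (v x * v x) + t ^ 2 * (w x * ⟪g x, g x⟫))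
      (volume.restrict univ) := i5.add (i6.const_mul _)
  have i8 : Integrable (fun x => v x * (w x * v x)
      + t ^ 2 * ⟪g x, w x • g x + v x • ∇ w x⟫) (volume.restrict univ) := i1.add (i2.const_mul _)
  have i9 : Integrable (fun x => v x * (w x * v x) + t ^ 2 * ⟪g x, w x • g x + v x • ∇ w x⟫
      + ψ x * (w x * v x)) (volume.restrict univ) := i8.add i3
  have hmono : ∫ x in univ, (w x * (v x * v x) + t ^ 2 * (w x * ⟪g x, g x⟫))
      ≤ ∫ x in univ, (4 * (v x * (w x * v x) + t ^ 2 * ⟪g x, w x • g x + v x • ∇ w x⟫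
        + ψ x * (w x * v x)) + 4 * a * (ψ x * ψ x)) :=
    integral_mono i7 ((i9.const_mul _).add (i4.const_mul _))
      fun x => weighted_pointwise (hw0 x) ht (hw' x) (ha x)
  have hR : ∫ x in univ, (4 * (v x * (w x * v x) + t ^ 2 * ⟪g x, w x • g x + v x • ∇ w x⟫
        + ψ x * (w x * v x)) + 4 * a * (ψ x * ψ x)) = 4 * a * l2Norm univ ψ ^ 2 := by
    rw [integral_add (i9.const_mul 4) (i4.const_mul _), integral_const_mul, integral_add i8 i3,
      integral_add i1 (i2.const_mul _), integral_const_mul, integral_const_mul, hE,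
      l2Norm_sq_real hψ]
    ring
  rw [hR] at hmono
  refine le_trans ?_ hmono
  rw [Measure.restrict_univ] at hv hg i7 ⊢
  rw [l2Norm_sq_real (hv.restrict B), l2Norm_sq_vector (hg.restrict B), ← integral_const_mul,
    ← integral_add (integrable_mul_of_memLp (hv.restrict B) (hv.restrict B))
      ((integrable_inner_of_memLp (hg.restrict B) (hg.restrict B)).const_mul _),
    ← integral_const_mul]
  refine (setIntegral_mono_on ?_ i7.integrableOn hB fun x hx => ?_).trans
    (setIntegral_le_integral i7 (Filter.Eventually.of_forall fun x => ?_))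
  · exact ((integrable_mul_of_memLp (hv.restrict B) (hv.restrict B)).add
      ((integrable_inner_of_memLp (hg.restrict B) (hg.restrict B)).const_mul _)).const_mul _
  · have e : w x * (v x * v x) + t ^ 2 * (w x * ⟪g x, g x⟫)
        = w x * (v x * v x + t ^ 2 * ⟪g x, g x⟫) := by ring
    rw [e]
    refine mul_le_mul_of_nonneg_right (hb x hx) ?_
    exact add_nonneg (mul_self_nonneg _) (mul_nonneg (sq_nonneg t) real_inner_self_nonneg)
  · exact add_nonneg (mul_nonneg (hw0 x).le (mul_self_nonneg _))
      (mul_nonneg (sq_nonneg t) (mul_nonneg (hw0 x).le real_inner_self_nonneg))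

theorem exists_exp_weight {Ω : Set (Eucl d)} (hΩ : Ω.Nonempty) {t R : ℝ} (ht : 0 < t) :
    ∃ w : Eucl d → ℝ, ContDiff ℝ ∞ w ∧ (∀ x, 0 < w x) ∧ (∃ A, ∀ x, w x ≤ A) ∧
      (∀ x, ‖∇ w x‖ ≤ w x / t) ∧ (∀ x ∈ Ω, w x ≤ Real.exp 1) ∧
      ∀ x, (∀ z ∈ Ω, R - t ≤ dist x z) → Real.exp (R / t - 2) ≤ w x := by
  have hf : LipschitzWith 1 fun x => min (infDist x Ω) R := (lipschitz_infDist_pt Ω).min_const R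
  obtain ⟨F, hF, hF', hFf, -⟩ := LipschitzWith.exists_contDiff_approx hf ht
  simp only [NNReal.coe_one, one_mul] at hF' hFf
  refine ⟨fun x => Real.exp (F x / t), (hF.div_const t).exp, fun x => Real.exp_pos _,
    ⟨Real.exp ((R + t) / t), fun x => ?_⟩, fun x => ?_, fun x hx => ?_, fun x hx => ?_⟩
  · have := (abs_le.1 (hFf x)).2
    have h2 : min (infDist x Ω) R ≤ R := min_le_right _ _
    exact Real.exp_le_exp.2 (div_le_div_of_nonneg_right (by linarith) ht.le)
  · have hd : HasFDerivAt (fun x => Real.exp (F x / t))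
        (Real.exp (F x / t) • (t⁻¹ • fderiv ℝ F x)) x := by
      have h1 : HasFDerivAt (fun x => F x / t) (t⁻¹ • fderiv ℝ F x) x := by
        simpa [div_eq_inv_mul] using
          (hF.differentiable (by simp) x).hasFDerivAt.const_mul t⁻¹
      exact h1.exp
    rw [norm_gradient, hd.fderiv, norm_smul, norm_smul, Real.norm_of_nonneg (Real.exp_pos _).le,
      norm_inv, Real.norm_of_nonneg ht.le, ← norm_gradient, div_eq_mul_inv]
    exact mul_le_mul_of_nonneg_left
      (mul_le_of_le_one_right (inv_nonneg.2 ht.le) (hF' x)) (Real.exp_pos _).le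
  · have := (abs_le.1 (hFf x)).2
    have h2 : min (infDist x Ω) R ≤ 0 := (min_le_left _ _).trans (infDist_zero_of_mem hx).le
    refine Real.exp_le_exp.2 ((div_le_one ht).2 (by linarith))
  · have := (abs_le.1 (hFf x)).1
    have h2 : R - t ≤ min (infDist x Ω) R :=
      le_min ((le_infDist hΩ).2 fun {z} hz => hx z hz) (by linarith)
    refine Real.exp_le_exp.2 ?_
    rw [le_div_iff₀ ht, sub_mul, div_mul_cancel₀ _ ht.ne']
    linarith

theorem decayEstimate_of_ball (hd : 1 ≤ d) {Ω D : Set (Eucl d)} (hΩo : IsOpen Ω)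
    (hΩ : Convex ℝ Ω) (hΩb : Bornology.IsBounded Ω) (h0 : (0 : Eucl d) ∈ Ω) {r : ℝ} (hr : 0 < r)
    (hrΩ : ball (0 : Eucl d) r ⊆ Ω) (hD : IsOpen D) (hDΩ : D ⊆ Ω) :
    DecayEstimate Ω D (r / 2) (3 * Real.exp (3 / 2)) := by
  intro M t hM ht η hη v g hv
  set R := max 1 t * (1 + M) * r with hR
  obtain ⟨w, hw, hw0, ⟨A, hA⟩, hw', hwΩ, hwB⟩ := exists_exp_weight (R := R) ⟨0, h0⟩ ht
  have hψ : MemLp (zeroExt D η) 2 (volume.restrict univ) := by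
    rwa [Measure.restrict_univ, memLp_indicator_iff_restrict hD.measurableSet]
  have hest := hv.weighted_estimate ht hψ hw hw0 hA hw' (a := Real.exp 1)
    (fun x hx => hwΩ x (hDΩ (mem_of_indicator_ne_zero hx)))
    (measurableSet_boundaryLayer t hΩo hM)
    (fun x hx => hwB x fun z hz => dist_boundaryLayer_ge t hd hΩo hΩ hΩb hM hrΩ hx hz)
  rw [l2Norm_zeroExt hD.measurableSet] at hest
  set X := l2Norm (boundaryLayer Ω M t) v
  set Y := l2Norm (boundaryLayer Ω M t) g
  set N := l2Norm D η
  have hN : 0 ≤ N := l2Norm_nonneg _ _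
  have hexp : Real.exp (-(R / (2 * t))) ≤ Real.exp (-(max 1 t * (r / 2) * M / t)) := by
    refine Real.exp_le_exp.2 (neg_le_neg ?_)
    rw [div_le_div_iff₀ ht (by positivity), hR]
    have : 0 ≤ max 1 t * r * t := by positivity
    nlinarith
  refine le_trans ?_ (mul_le_mul_of_nonneg_right (mul_le_mul_of_nonneg_left hexp (by positivity)) hN)
  refine le_of_sq_le_sq ?_ (by positivity)
  have hsq : (3 * Real.exp (3 / 2) * Real.exp (-(R / (2 * t))) * N) ^ 2
      = 9 * (Real.exp 1 * (Real.exp (R / t - 2))⁻¹) * N ^ 2 := by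
    rw [mul_pow, mul_pow, mul_pow, ← Real.exp_nat_mul, ← Real.exp_nat_mul, ← Real.exp_neg,
      ← Real.exp_add, mul_assoc (3 ^ 2 : ℝ), ← Real.exp_add]
    norm_num
    left
    field_simp
    ring
  have hb : X ^ 2 + t ^ 2 * Y ^ 2 ≤ 4 * (Real.exp 1 * (Real.exp (R / t - 2))⁻¹) * N ^ 2 := by
    have hp := Real.exp_pos (R / t - 2)
    rw [← mul_le_mul_iff_right₀ hp]
    refine hest.trans (le_of_eq ?_)
    field_simp
  have hnn : 0 ≤ Real.exp 1 * (Real.exp (R / t - 2))⁻¹ * N ^ 2 := by positivity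
  rw [hsq]
  nlinarith [sq_nonneg (t * Y - X)]

theorem l2Norm_mono_set {F : Type*} [NormedAddCommGroup F] {D U : Set (Eucl d)} (hDU : D ⊆ U)
    {f : Eucl d → F} (hf : MemLp f 2 (volume.restrict U)) : l2Norm D f ≤ l2Norm U f :=
  ENNReal.toReal_mono hf.eLpNorm_ne_top (eLpNorm_mono_measure f (Measure.restrict_mono_set _ hDU))

theorem l2Norm_le_of_eq_zero_off {F G : Type*} [NormedAddCommGroup F] [NormedAddCommGroup G]
    {U L : Set (Eucl d)} (hU : MeasurableSet U) (hL : MeasurableSet L) (hLU : L ⊆ U)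
    {f : Eucl d → F} {k : Eucl d → G} (hk : MemLp k 2 (volume.restrict L))
    (hfk : ∀ x ∈ L, ‖f x‖ ≤ ‖k x‖) (h0 : ∀ x ∈ U, x ∉ L → f x = 0) :
    l2Norm U f ≤ l2Norm L k := by
  refine ENNReal.toReal_mono hk.eLpNorm_ne_top ?_
  have h1 : eLpNorm f 2 (volume.restrict U) ≤ eLpNorm (L.indicator k) 2 (volume.restrict U) := by
    refine eLpNorm_mono_ae ((ae_restrict_iff' hU).2 (Filter.Eventually.of_forall fun x hx => ?_))
    by_cases hxL : x ∈ L
    · rw [indicator_of_mem hxL]; exact hfk x hxL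
    · rw [h0 x hx hxL, norm_zero]; exact norm_nonneg _
  rwa [eLpNorm_indicator_eq_eLpNorm_restrict hL, Measure.restrict_restrict hL,
    inter_eq_left.2 hLU] at h1

theorem l2Norm_const_mul_norm_le {F : Type*} [NormedAddCommGroup F]
    {U : Set (Eucl d)} {f : Eucl d → F} {c : ℝ} (hc : 0 ≤ c) :
    l2Norm U (fun x => c * ‖f x‖) = c * l2Norm U f := by
  have : eLpNorm (c • fun x => ‖f x‖) 2 (volume.restrict U)
      = ‖c‖ₑ * eLpNorm f 2 (volume.restrict U) := by
    rw [eLpNorm_const_smul, eLpNorm_norm]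
  change (eLpNorm (c • fun x => ‖f x‖) 2 (volume.restrict U)).toReal = _
  rw [this, ENNReal.toReal_mul, toReal_enorm, Real.norm_of_nonneg hc, l2Norm]

theorem l2Norm_add_le {F : Type*} [NormedAddCommGroup F] {U : Set (Eucl d)} {f g : Eucl d → F}
    (hf : MemLp f 2 (volume.restrict U)) (hg : MemLp g 2 (volume.restrict U)) :
    l2Norm U (fun x => f x + g x) ≤ l2Norm U f + l2Norm U g := by
  rw [l2Norm, l2Norm, l2Norm, ← ENNReal.toReal_add hf.eLpNorm_ne_top hg.eLpNorm_ne_top]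
  exact ENNReal.toReal_mono (ENNReal.add_ne_top.2 ⟨hf.eLpNorm_ne_top, hg.eLpNorm_ne_top⟩)
    (eLpNorm_add_le hf.1 hg.1 (by norm_num))

theorem MemH10.sub {U : Set (Eucl d)} {u v : Eucl d → ℝ} {g h : Eucl d → Eucl d}
    (hu : MemH10 U u g) (hv : MemH10 U v h) : MemH10 U (u - v) (g - h) := by
  obtain ⟨K, -, hK⟩ := isClosedForm_memH10 U
  obtain ⟨a, b, hm⟩ := (hK u g).1 hu
  obtain ⟨a', b', hm'⟩ := (hK v h).1 hv
  exact (hK _ _).2 ⟨a.sub a', b.sub b', K.sub_mem hm hm'⟩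

theorem IsWholeSol.apply_memH10 {U : Set (Eucl d)} (hU : MeasurableSet U) {t : ℝ}
    {ψ v φ : Eucl d → ℝ} {g h : Eucl d → Eucl d} (hv : IsWholeSol t ψ v g) (hφ : MemH10 U φ h) :
    (∫ x in U, v x * φ x) + t ^ 2 * (∫ x in U, ⟪g x, h x⟫) = - ∫ x in U, ψ x * φ x := by
  have hE := hv.2 _ _ (hφ.memH1_indicator hU)
  have e1 (f : Eucl d → ℝ) : ∫ x in univ, f x * U.indicator φ x = ∫ x in U, f x * φ x := by
    rw [Measure.restrict_univ, ← integral_indicator hU]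
    exact integral_congr_ae (Filter.Eventually.of_forall fun x => by
      by_cases hx : x ∈ U <;> simp [hx])
  have e2 : ∫ x in univ, ⟪g x, U.indicator h x⟫ = ∫ x in U, ⟪g x, h x⟫ := by
    rw [Measure.restrict_univ, ← integral_indicator hU]
    exact integral_congr_ae (Filter.Eventually.of_forall fun x => by
      by_cases hx : x ∈ U <;> simp [hx])
  rwa [e1, e1, e2] at hE

/-- A Céa type estimate: the error of the Dirichlet solution is bounded by the distance of the
whole-space solution to any element of the Dirichlet space. -/
theorem IsDirichletSol.error_le {U : Set (Eucl d)} (hU : MeasurableSet U) {t : ℝ} (ht : 0 < t)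
    {ψ v v' z : Eucl d → ℝ} {g g' h : Eucl d → Eucl d}
    (hv : IsWholeSol t ψ v g) (hv' : IsDirichletSol U t ψ v' g') (hz : MemH10 U z h) :
    l2Norm U (fun x => v x - v' x)
      ≤ l2Norm U (fun x => v x - z x) + t * l2Norm U (fun x => g x - h x) := by
  have hvm : MemLp v 2 (volume.restrict U) := by
    have := hv.1.1; rw [Measure.restrict_univ] at this; exact this.restrict U
  have hgm : MemLp g 2 (volume.restrict U) := by
    have := hv.1.2.1; rw [Measure.restrict_univ] at this; exact this.restrict U
  have hd := hz.sub hv'.1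
  have h1 := hv.apply_memH10 hU hd
  have h2 := hv'.2 _ _ hd
  have he : MemLp (fun x => v x - v' x) 2 (volume.restrict U) := hvm.sub hv'.1.1
  have hE : MemLp (fun x => g x - g' x) 2 (volume.restrict U) := hgm.sub hv'.1.2.1
  have hp : MemLp (fun x => v x - z x) 2 (volume.restrict U) := hvm.sub hz.1
  have hq : MemLp (fun x => g x - h x) 2 (volume.restrict U) := hgm.sub hz.2.1
  have e1 : ∫ x in U, (v x - v' x) * (v x - v' x) = (∫ x in U, v x * (z - v') x)
      - (∫ x in U, v' x * (z - v') x) + ∫ x in U, (v x - v' x) * (v x - z x) := by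
    have i1 := integrable_mul_of_memLp hvm hd.1
    have i2 := integrable_mul_of_memLp hv'.1.1 hd.1
    have i3 : Integrable (fun x => v x * (z - v') x - v' x * (z - v') x) (volume.restrict U) :=
      i1.sub i2
    rw [← integral_sub i1 i2, ← integral_add i3 (integrable_mul_of_memLp he hp)]
    refine integral_congr_ae (Filter.Eventually.of_forall fun x => ?_)
    simp only [Pi.sub_apply]; ring
  have e2 : ∫ x in U, ⟪g x - g' x, g x - g' x⟫ = (∫ x in U, ⟪g x, (h - g') x⟫)
      - (∫ x in U, ⟪g' x, (h - g') x⟫) + ∫ x in U, ⟪g x - g' x, g x - h x⟫ := by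
    have i1 := integrable_inner_of_memLp hgm hd.2.1
    have i2 := integrable_inner_of_memLp hv'.1.2.1 hd.2.1
    have i3 : Integrable (fun x => ⟪g x, (h - g') x⟫ - ⟪g' x, (h - g') x⟫) (volume.restrict U) :=
      i1.sub i2
    rw [← integral_sub i1 i2, ← integral_add i3 (integrable_inner_of_memLp hE hq)]
    refine integral_congr_ae (Filter.Eventually.of_forall fun x => ?_)
    simp only [Pi.sub_apply, inner_sub_left, inner_sub_right]; ring
  rw [← l2Norm_sq_real he] at e1
  rw [← l2Norm_sq_vector hE] at e2
  have b1 := (abs_le.1 (abs_integral_mul_le he hp)).2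
  have b2 := (abs_le.1 (abs_integral_inner_le hE hq)).2
  set X := l2Norm U (fun x => v x - v' x)
  set Y := l2Norm U (fun x => g x - g' x)
  set p := l2Norm U (fun x => v x - z x)
  set q := l2Norm U (fun x => g x - h x)
  have hp0 : 0 ≤ p := l2Norm_nonneg _ _
  have hq0 : 0 ≤ q := l2Norm_nonneg _ _
  have key : X ^ 2 + t ^ 2 * Y ^ 2 ≤ X * p + t ^ 2 * (Y * q) := by
    have := mul_le_mul_of_nonneg_left b2 (sq_nonneg t)
    nlinarith
  have htq : 0 ≤ p * (t * q) := by positivity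
  refine le_of_sq_le_sq ?_ (by positivity)
  nlinarith [sq_nonneg (X - p), sq_nonneg (t * Y - t * q), sq_nonneg (t * Y)]

/-- A smooth function that vanishes near the complement of `U`, and equals one at distance at
least `t` from it. -/
theorem exists_cutoff (U : Set (Eucl d)) {t : ℝ} (ht : 0 < t) :
    ∃ F : Eucl d → ℝ, ContDiff ℝ ∞ F ∧ (∀ x, ‖∇ F x‖ ≤ 3 / t) ∧ (∀ x, |F x| ≤ 3 / 2) ∧
      (∀ x, |1 - F x| ≤ 3 / 2) ∧ (∀ x, infDist x Uᶜ ≤ t / 6 → F x = 0) ∧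
      ∀ x, 5 * t / 6 ≤ infDist x Uᶜ → F x = 1 := by
  let K : ℝ≥0 := ⟨3 / t, by positivity⟩
  have hK : (K : ℝ) = 3 / t := rfl
  have h1 : LipschitzWith K fun s : ℝ => 3 / t * s - 1 := LipschitzWith.of_dist_le_mul fun a b => by
    rw [Real.dist_eq, Real.dist_eq, hK]
    have : 3 / t * a - 1 - (3 / t * b - 1) = 3 / t * (a - b) := by ring
    rw [this, abs_mul, abs_of_pos (by positivity : 0 < 3 / t)]
  have hf : LipschitzWith K fun x => max 0 (min 1 (3 / t * infDist x Uᶜ - 1)) := by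
    have := ((h1.const_min 1).const_max 0).comp (lipschitz_infDist_pt Uᶜ)
    rwa [mul_one] at this
  obtain ⟨F, hF, hF', hFf, hFc⟩ := LipschitzWith.exists_contDiff_approx hf
    (show 0 < t / 6 by positivity)
  have hKt : (K : ℝ) * (t / 6) = 1 / 2 := by rw [hK]; field_simp; norm_num
  rw [hKt] at hFf
  have hr (x) : 0 ≤ max 0 (min 1 (3 / t * infDist x Uᶜ - 1)) ∧
      max 0 (min 1 (3 / t * infDist x Uᶜ - 1)) ≤ 1 :=
    ⟨le_max_left _ _, max_le zero_le_one (min_le_left _ _)⟩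
  have hlow (x) (hx : infDist x Uᶜ ≤ t / 3) : max 0 (min 1 (3 / t * infDist x Uᶜ - 1)) = 0 := by
    refine max_eq_left ((min_le_right _ _).trans ?_)
    rw [sub_nonpos, div_mul_eq_mul_div, div_le_one ht]
    linarith
  have hhigh (x) (hx : 2 * t / 3 ≤ infDist x Uᶜ) :
      max 0 (min 1 (3 / t * infDist x Uᶜ - 1)) = 1 := by
    rw [min_eq_left, max_eq_right zero_le_one]
    rw [le_sub_iff_add_le, div_mul_eq_mul_div, le_div_iff₀ ht]
    linarith
  refine ⟨F, hF, hF', fun x => ?_, fun x => ?_, fun x hx => ?_, fun x hx => ?_⟩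
  · have := abs_le.1 (hFf x)
    exact abs_le.2 ⟨by linarith [(hr x).1], by linarith [(hr x).2]⟩
  · have := abs_le.1 (hFf x)
    exact abs_le.2 ⟨by linarith [(hr x).2], by linarith [(hr x).1]⟩
  · rw [hFc x fun y hy => ?_, hlow x (by linarith)]
    have := infDist_le_infDist_add_dist (x := y) (y := x) (s := Uᶜ)
    rw [hlow x (by linarith), hlow y (by linarith [mem_ball.1 hy])]
  · rw [hFc x fun y hy => ?_, hhigh x (by linarith)]
    have := infDist_le_infDist_add_dist (x := x) (y := y) (s := Uᶜ)
    rw [hhigh x (by linarith), hhigh y (by linarith [mem_ball'.1 hy])]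

theorem truncation_error_le {U : Set (Eucl d)} (hUo : IsOpen U) (hUb : Bornology.IsBounded U)
    (hU : U ≠ univ) {t : ℝ} (ht : 0 < t)
    {ψ v v' : Eucl d → ℝ} {g g' : Eucl d → Eucl d}
    (hv : IsWholeSol t ψ v g) (hv' : IsDirichletSol U t ψ v' g') :
    l2Norm U (fun x => v x - v' x) ≤ 5 * (t * l2Norm {x ∈ U | infDist x (frontier U) < t} g
      + l2Norm {x ∈ U | infDist x (frontier U) < t} v) := by
  set L := {x ∈ U | infDist x (frontier U) < t} with hLdef
  have hL : MeasurableSet L :=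
    (hUo.inter (isOpen_lt (continuous_infDist_pt _) continuous_const)).measurableSet
  have hLU : L ⊆ U := fun x hx => hx.1
  obtain ⟨F, hF, hF', hFb, hFb', hF0, hF1⟩ := exists_cutoff U ht
  have hUc : Uᶜ.Nonempty := nonempty_compl.2 hU
  have hz := (hv.1.mul_smooth hF hFb hF').memH10_of_compact hUo
    (K := {x | t / 6 ≤ infDist x Uᶜ}) ?_ ?_ ?_
  rotate_left
  · refine isCompact_of_isClosed_isBounded
      (isClosed_le continuous_const (continuous_infDist_pt _)) (hUb.subset fun x hx => ?_)
    by_contra hxU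
    have : infDist x Uᶜ = 0 := infDist_zero_of_mem hxU
    have hx' : t / 6 ≤ infDist x Uᶜ := hx
    linarith
  · intro x hx
    by_contra hxU
    have : infDist x Uᶜ = 0 := infDist_zero_of_mem hxU
    have hx' : t / 6 ≤ infDist x Uᶜ := hx
    linarith
  · intro x hx
    rw [hF0 x (not_le.1 hx).le, zero_mul]
  have hfar : ∀ x ∈ U, x ∉ L → t ≤ infDist x Uᶜ := by
    intro x hxU hxL
    obtain ⟨y, hy, hxy⟩ := exists_mem_frontier_infDist_compl_eq_dist hxU hU
    rw [hxy]
    exact (not_lt.1 fun h => hxL ⟨hxU, h⟩).trans (infDist_le_dist_of_mem hy)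
  have hone : ∀ x ∈ U, x ∉ L → F x = 1 := fun x hxU hxL =>
    hF1 x (le_trans (by linarith) (hfar x hxU hxL))
  have hgrad : ∀ x ∈ U, x ∉ L → ∇ F x = 0 := by
    intro x hxU hxL
    have hev : F =ᶠ[nhds x] fun _ => 1 := by
      have ho : IsOpen {y | 5 * t / 6 < infDist y Uᶜ} :=
        isOpen_lt continuous_const (continuous_infDist_pt _)
      filter_upwards [ho.mem_nhds (show 5 * t / 6 < infDist x Uᶜ by
        linarith [hfar x hxU hxL])] with y hy
      exact hF1 y (le_of_lt hy)
    rw [← norm_eq_zero, norm_gradient, hev.fderiv_eq]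
    simp
  have hvL : MemLp v 2 (volume.restrict L) := by
    have := hv.1.1; rw [Measure.restrict_univ] at this; exact this.restrict L
  have hgL : MemLp g 2 (volume.restrict L) := by
    have := hv.1.2.1; rw [Measure.restrict_univ] at this; exact this.restrict L
  have hp : l2Norm U (fun x => v x - F x * v x) ≤ 3 / 2 * l2Norm L v := by
    rw [← l2Norm_const_mul_norm_le (by norm_num)]
    refine l2Norm_le_of_eq_zero_off hUo.measurableSet hL hLU (hvL.norm.const_mul _)
      (fun x _ => ?_) fun x hx hxL => by rw [hone x hx hxL]; ring
    have : v x - F x * v x = (1 - F x) * v x := by ring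
    rw [this, norm_mul, norm_mul, norm_norm, Real.norm_of_nonneg (by norm_num : (0 : ℝ) ≤ 3 / 2)]
    exact mul_le_mul_of_nonneg_right (hFb' x) (norm_nonneg _)
  have hq : l2Norm U (fun x => g x - (F x • g x + v x • ∇ F x))
      ≤ 3 / 2 * l2Norm L g + 3 / t * l2Norm L v := by
    rw [← l2Norm_const_mul_norm_le (by norm_num), ← l2Norm_const_mul_norm_le (by positivity)]
    refine le_trans ?_ (l2Norm_add_le (hgL.norm.const_mul _) (hvL.norm.const_mul _))
    refine l2Norm_le_of_eq_zero_off hUo.measurableSet hL hLU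
      ((hgL.norm.const_mul _).add (hvL.norm.const_mul _))
      (fun x _ => ?_) fun x hx hxL => by rw [hone x hx hxL, hgrad x hx hxL]; simp
    have : g x - (F x • g x + v x • ∇ F x) = (1 - F x) • g x - v x • ∇ F x := by
      rw [sub_smul, one_smul]; abel
    rw [this, Real.norm_of_nonneg (by positivity)]
    refine (norm_sub_le _ _).trans (add_le_add ?_ ?_)
    · rw [norm_smul]
      exact mul_le_mul_of_nonneg_right (hFb' x) (norm_nonneg _)
    · rw [norm_smul, mul_comm]
      exact mul_le_mul_of_nonneg_right (hF' x) (norm_nonneg _)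
  refine (hv'.error_le hUo.measurableSet ht hv hz).trans ?_
  have hq' := mul_le_mul_of_nonneg_left hq ht.le
  have e : t * (3 / 2 * l2Norm L g + 3 / t * l2Norm L v)
      = 3 / 2 * (t * l2Norm L g) + 3 * l2Norm L v := by
    field_simp
  rw [e] at hq'
  have n1 := mul_nonneg ht.le (l2Norm_nonneg L g)
  have n2 := l2Norm_nonneg L v
  linarith

theorem mul_sum_exp_neg_natAbs_le {q : ℝ} (hq : 0 < q) {S : Finset ℤ}
    (hS : Set.InjOn Int.natAbs (S : Set ℤ)) :
    q * ∑ j ∈ S, Real.exp (-(q * (j.natAbs : ℝ))) ≤ 1 + q := by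
  have hlt : Real.exp (-q) < 1 := Real.exp_lt_one_iff.2 (by linarith)
  have hsum : ∑ j ∈ S, Real.exp (-(q * (j.natAbs : ℝ))) ≤ (1 - Real.exp (-q))⁻¹ := by
    rw [← tsum_geometric_of_lt_one (Real.exp_pos _).le hlt]
    have e : ∑ j ∈ S, Real.exp (-(q * (j.natAbs : ℝ)))
        = ∑ i ∈ S.image Int.natAbs, Real.exp (-q) ^ i := by
      rw [Finset.sum_image hS]
      refine Finset.sum_congr rfl fun j _ => ?_
      rw [← Real.exp_nat_mul]
      congr 1
      ring
    rw [e]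
    exact (summable_geometric_of_lt_one (Real.exp_pos _).le hlt).sum_le_tsum _
      fun i _ => by positivity
  refine (mul_le_mul_of_nonneg_left hsum hq.le).trans ?_
  have h1 : 0 < 1 - Real.exp (-q) := by linarith
  rw [← div_eq_mul_inv, div_le_iff₀ h1]
  have h2 : (1 + q) * Real.exp (-q) ≤ 1 := by
    rw [Real.exp_neg, mul_inv_le_iff₀ (Real.exp_pos q), one_mul]
    linarith [Real.add_one_le_exp q]
  linarith

theorem cs_nonneg {s : ℝ} (hs0 : 0 ≤ s) (hs1 : s ≤ 1) : 0 ≤ cs s := by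
  have hπ := Real.pi_pos
  have : 0 ≤ Real.sin (Real.pi * s) :=
    Real.sin_nonneg_of_nonneg_of_le_pi (by positivity) (mul_le_of_le_one_right hπ.le hs1)
  unfold cs
  positivity

theorem cs_le_two_mul {s : ℝ} (hs0 : 0 ≤ s) : cs s ≤ 2 * s := by
  have hπ := Real.pi_pos
  rw [cs, div_le_iff₀ hπ]
  linarith [Real.sin_le (mul_nonneg hπ.le hs0)]

theorem cs_le_two (s : ℝ) : cs s ≤ 2 := by
  rw [cs, div_le_iff₀ Real.pi_pos]
  linarith [Real.sin_le_one (Real.pi * s), Real.two_le_pi]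

theorem exp_mul_decay_le {s k c M : ℝ} (hs0 : 0 < s) (hk : 0 < k) (hc : 0 < c)
    (hM : 2 * (s + 1) / c < M) (j : ℤ) :
    Real.exp (s * yNode k j) * Real.exp (-(max 1 (tNode k j) * c * M / tNode k j))
      ≤ Real.exp (-(c * M)) * if j ≤ 0 then Real.exp (-(s * k * (j.natAbs : ℝ)))
        else Real.exp (-(k * (j.natAbs : ℝ))) := by
  have hcM : 2 * (s + 1) < M * c := (div_lt_iff₀ hc).1 hM
  have htpos : 0 < tNode k j := Real.exp_pos _
  rw [← Real.exp_add]
  split_ifs with hj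
  · rw [← Real.exp_add]
    have hjr : (j : ℝ) ≤ 0 := by exact_mod_cast hj
    have hn : (j.natAbs : ℝ) = -(j : ℝ) := by
      rw [Nat.cast_natAbs, Int.cast_abs, abs_of_nonpos hjr]
    have ht : 1 ≤ tNode k j := by
      refine Real.one_le_exp ?_
      have : yNode k j ≤ 0 := mul_nonpos_of_nonpos_of_nonneg hjr hk.le
      linarith
    rw [max_eq_right ht, hn, mul_assoc (tNode k j), mul_div_cancel_left₀ _ htpos.ne', yNode]
    exact Real.exp_le_exp.2 (le_of_eq (by ring))
  · rw [← Real.exp_add]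
    have hjr : (0 : ℝ) < j := by exact_mod_cast not_le.1 hj
    have hn : (j.natAbs : ℝ) = (j : ℝ) := by
      rw [Nat.cast_natAbs, Int.cast_abs, abs_of_pos hjr]
    have hy : 0 < yNode k j := mul_pos hjr hk
    have ht : tNode k j ≤ 1 := Real.exp_le_one_iff.2 (by linarith)
    have hinv : (tNode k j)⁻¹ = Real.exp (yNode k j / 2) := by
      rw [tNode, ← Real.exp_neg]
      congr 1
      ring
    rw [max_eq_left ht, one_mul, hn, div_eq_mul_inv, hinv]
    refine Real.exp_le_exp.2 ?_
    have h1 := Real.add_one_le_exp (yNode k j / 2)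
    have hcM0 : 0 < c * M := by linarith
    have h2 := mul_le_mul_of_nonneg_left h1 hcM0.le
    have h3 : k * (j : ℝ) = yNode k j := mul_comm _ _
    rw [h3]
    nlinarith

theorem quadrature_weight_sum_le {s k c M : ℝ} (hs0 : 0 < s) (hs1 : s < 1) (hk : 0 < k)
    (hc : 0 < c) (hM : 2 * (s + 1) / c < M) (S : Finset ℤ) :
    cs s * k / 2 * ∑ j ∈ S, Real.exp (s * yNode k j)
        * Real.exp (-(max 1 (tNode k j) * c * M / tNode k j))
      ≤ (2 + 2 * k) * Real.exp (-(c * M)) := by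
  have hcs := cs_nonneg hs0.le hs1.le
  refine (mul_le_mul_of_nonneg_left (Finset.sum_le_sum fun j _ =>
    exp_mul_decay_le hs0 hk hc hM j) (by positivity)).trans ?_
  rw [← Finset.mul_sum, Finset.sum_ite, mul_left_comm, mul_comm (Real.exp _)]
  refine mul_le_mul_of_nonneg_right ?_ (Real.exp_pos _).le
  have i1 : Set.InjOn Int.natAbs ((S.filter fun j => j ≤ 0 : Finset ℤ) : Set ℤ) := by
    intro a ha b hb hab
    simp only [Finset.coe_filter, mem_ofPred_eq] at ha hb
    omega
  have i2 : Set.InjOn Int.natAbs ((S.filter fun j => ¬ j ≤ 0 : Finset ℤ) : Set ℤ) := by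
    intro a ha b hb hab
    simp only [Finset.coe_filter, mem_ofPred_eq] at ha hb
    omega
  have h1 := mul_sum_exp_neg_natAbs_le (mul_pos hs0 hk) i1
  have h2 := mul_sum_exp_neg_natAbs_le hk i2
  have p1 : 0 ≤ k * ∑ j ∈ S with j ≤ 0, Real.exp (-(s * k * (j.natAbs : ℝ))) := by positivity
  have p2 : 0 ≤ k * ∑ j ∈ S with ¬ j ≤ 0, Real.exp (-(k * (j.natAbs : ℝ))) := by positivity
  have q1 := mul_le_mul_of_nonneg_right (cs_le_two_mul hs0.le) p1
  have q2 := mul_le_mul_of_nonneg_right (cs_le_two s) p2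
  have hsk : s * k ≤ k := mul_le_of_le_one_left hk.le hs1.le
  linarith

theorem abs_pairing_difference_le (hd : 1 ≤ d) {Ω D : Set (Eucl d)} (hΩo : IsOpen Ω)
    (hΩ : Convex ℝ Ω) (hΩb : Bornology.IsBounded Ω) (h0 : (0 : Eucl d) ∈ Ω)
    (hD : IsOpen D) (hDΩ : D ⊆ Ω) {c C₁ : ℝ} (hdec : DecayEstimate Ω D c C₁) {M t : ℝ}
    (hM : 0 < M) (ht : 0 < t) {η θ : Eucl d → ℝ} (hη : MemLp η 2 (volume.restrict D))
    (hθ : MemLp θ 2 (volume.restrict D)) :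
    |(∫ x in D, wWhole t (zeroExt D η) x * θ x) - ∫ x in D, wTrunc Ω M t (zeroExt D η) x * θ x|
      ≤ 5 * |C₁| * Real.exp (-(max 1 t * c * M / t)) * (l2Norm D η * l2Norm D θ) := by
  set U := dilatedDomain Ω M t
  have hUo : IsOpen U := isOpen_dilatedDomain t hΩo hM
  have hUb : Bornology.IsBounded U := isBounded_dilatedDomain t hΩb
  have hDU : D ⊆ U := hDΩ.trans (subset_dilatedDomain t hΩ h0 hM)
  have hψ : MemLp (zeroExt D η) 2 volume := (memLp_indicator_iff_restrict hD.measurableSet).2 hη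
  obtain ⟨g, hv⟩ := vWhole_spec ht hψ
  obtain ⟨g', hv'⟩ := vDirichlet_spec ht (hψ.restrict U)
  have hvm : MemLp (vWhole t (zeroExt D η)) 2 volume := by simpa using hv.1.1
  have hv'm := hv'.1.1
  have herr := truncation_error_le hUo hUb (ne_univ_of_isBounded hd hUb) ht hv hv'
  have hdecay := hdec M t hM ht η hη _ g hv
  have hdm : MemLp (fun x => vWhole t (zeroExt D η) x - vDirichlet U t (zeroExt D η) x) 2
      (volume.restrict U) := (hvm.restrict U).sub hv'm
  have hv'D : MemLp (vDirichlet U t (zeroExt D η)) 2 (volume.restrict D) :=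
    hv'm.mono_measure (Measure.restrict_mono_set _ hDU)
  have i1 : Integrable (fun x => wWhole t (zeroExt D η) x * θ x) (volume.restrict D) :=
    integrable_mul_of_memLp ((hψ.restrict D).add (hvm.restrict D)) hθ
  have i2 : Integrable (fun x => wTrunc Ω M t (zeroExt D η) x * θ x) (volume.restrict D) :=
    integrable_mul_of_memLp ((hψ.restrict D).add hv'D) hθ
  have e : (∫ x in D, wWhole t (zeroExt D η) x * θ x)
        - ∫ x in D, wTrunc Ω M t (zeroExt D η) x * θ x
      = ∫ x in D, (vWhole t (zeroExt D η) x - vDirichlet U t (zeroExt D η) x) * θ x := by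
    rw [← integral_sub i1 i2]
    refine integral_congr_ae (Filter.Eventually.of_forall fun x => ?_)
    simp only [wWhole, wTrunc]
    ring
  rw [e]
  refine (abs_integral_mul_le ((hvm.restrict D).sub hv'D) hθ).trans ?_
  rw [← mul_assoc]
  refine mul_le_mul_of_nonneg_right ?_ (l2Norm_nonneg _ _)
  refine (l2Norm_mono_set hDU hdm).trans (herr.trans ?_)
  have hC : C₁ * Real.exp (-(max 1 t * c * M / t)) * l2Norm D η
      ≤ |C₁| * Real.exp (-(max 1 t * c * M / t)) * l2Norm D η :=
    mul_le_mul_of_nonneg_right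
      (mul_le_mul_of_nonneg_right (le_abs_self _) (Real.exp_pos _).le) (l2Norm_nonneg _ _)
  have := hdecay.trans hC
  change 5 * (t * l2Norm (boundaryLayer Ω M t) g + l2Norm (boundaryLayer Ω M t) _) ≤ _
  linarith

theorem abs_aQuad_sub_aQuadTrunc_le (hd : 1 ≤ d) {Ω D : Set (Eucl d)} (hΩo : IsOpen Ω)
    (hΩ : Convex ℝ Ω) (hΩb : Bornology.IsBounded Ω) (h0 : (0 : Eucl d) ∈ Ω)
    (hD : IsOpen D) (hDΩ : D ⊆ Ω) {c C₁ : ℝ} (hc : 0 < c) (hdec : DecayEstimate Ω D c C₁)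
    {s M k : ℝ} (hs0 : 0 < s) (hs1 : s < 1) (hM : 2 * (s + 1) / c < M) (hk : 0 < k)
    (Nm Np : ℕ) {η θ : Eucl d → ℝ} (hη : MemLp η 2 (volume.restrict D))
    (hθ : MemLp θ 2 (volume.restrict D)) :
    |aQuad D s k Nm Np η θ - aQuadTrunc Ω D M s k Nm Np η θ|
      ≤ 5 * |C₁| * (2 + 2 * k) * Real.exp (-(c * M)) * (l2Norm D η * l2Norm D θ) := by
  have hM0 : 0 < M := lt_trans (by positivity) hM
  have hw : 0 ≤ cs s * k / 2 := by
    have := cs_nonneg hs0.le hs1.le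
    positivity
  have hN : 0 ≤ 5 * |C₁| * (l2Norm D η * l2Norm D θ) :=
    mul_nonneg (by positivity) (mul_nonneg (l2Norm_nonneg _ _) (l2Norm_nonneg _ _))
  rw [aQuad, aQuadTrunc, ← mul_sub, ← Finset.sum_sub_distrib, abs_mul, abs_of_nonneg hw]
  have hterm : |∑ j ∈ Finset.Icc (-(Nm : ℤ)) Np,
      (Real.exp (s * yNode k j) * (∫ x in D, wWhole (tNode k j) (zeroExt D η) x * θ x)
        - Real.exp (s * yNode k j) * ∫ x in D, wTrunc Ω M (tNode k j) (zeroExt D η) x * θ x)|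
      ≤ (∑ j ∈ Finset.Icc (-(Nm : ℤ)) Np, Real.exp (s * yNode k j)
        * Real.exp (-(max 1 (tNode k j) * c * M / tNode k j)))
        * (5 * |C₁| * (l2Norm D η * l2Norm D θ)) := by
    rw [Finset.sum_mul]
    refine (Finset.abs_sum_le_sum_abs _ _).trans (Finset.sum_le_sum fun j _ => ?_)
    rw [← mul_sub, abs_mul, abs_of_pos (Real.exp_pos _), mul_assoc]
    refine mul_le_mul_of_nonneg_left ?_ (Real.exp_pos _).le
    refine (abs_pairing_difference_le hd hΩo hΩ hΩb h0 hD hDΩ hdec hM0 (Real.exp_pos _)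
      hη hθ).trans (le_of_eq ?_)
    unfold tNode
    ring
  refine (mul_le_mul_of_nonneg_left hterm hw).trans ?_
  rw [← mul_assoc]
  refine (mul_le_mul_of_nonneg_right
    (quadrature_weight_sum_le hs0 hs1 hk hc hM _) hN).trans (le_of_eq ?_)
  ring

end FracTrunc

end

theorem mainTheorem4 (d : ℕ) (hd : 1 ≤ d) (Ω : Set (FracTrunc.Eucl d))
    (hΩo : IsOpen Ω) (hΩc : Convex ℝ Ω) (hΩb : Bornology.IsBounded Ω) (hΩ0 : (0 : FracTrunc.Eucl d) ∈ Ω) :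
    (∃ c : ℝ, 0 < c ∧ ∃ C₁ : ℝ, 0 < C₁ ∧
      ∀ D : Set (FracTrunc.Eucl d), IsOpen D → D ⊆ Ω → FracTrunc.DecayEstimate Ω D c C₁) ∧
    (∀ c : ℝ, 0 < c → ∀ C₁ : ℝ, ∀ k₀ : ℝ, 0 < k₀ → ∃ C : ℝ, 0 < C ∧
      ∀ D : Set (FracTrunc.Eucl d), IsOpen D → D ⊆ Ω → FracTrunc.DecayEstimate Ω D c C₁ →
      ∀ s : ℝ, 0 < s → s < 1 → ∀ M : ℝ, 2 * (s + 1) / c < M →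
      ∀ k : ℝ, 0 < k → k ≤ k₀ → ∀ Nm Np : ℕ,
      ∀ η θ : FracTrunc.Eucl d → ℝ,
        MemLp η 2 (volume.restrict D) → MemLp θ 2 (volume.restrict D) →
        |FracTrunc.aQuad D s k Nm Np η θ - FracTrunc.aQuadTrunc Ω D M s k Nm Np η θ|
          ≤ C * Real.exp (-(c * M)) * FracTrunc.l2Norm D η * FracTrunc.l2Norm D θ) := by
  refine ⟨?_, fun c hc C₁ k₀ hk₀ => ⟨5 * (|C₁| + 1) * (2 + 2 * k₀), by positivity, ?_⟩⟩
  · obtain ⟨r, hr, hrΩ⟩ := Metric.isOpen_iff.1 hΩo 0 hΩ0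
    exact ⟨r / 2, half_pos hr, 3 * Real.exp (3 / 2), by positivity, fun D hD hDΩ =>
      FracTrunc.decayEstimate_of_ball hd hΩo hΩc hΩb hΩ0 hr hrΩ hD hDΩ⟩
  · intro D hD hDΩ hdec s hs0 hs1 M hM k hk hkk₀ Nm Np η θ hη hθ
    refine (FracTrunc.abs_aQuad_sub_aQuadTrunc_le hd hΩo hΩc hΩb hΩ0 hD hDΩ hc hdec hs0 hs1 hM hk
      Nm Np hη hθ).trans ?_
    rw [mul_assoc _ (FracTrunc.l2Norm D η)]
    refine mul_le_mul_of_nonneg_right (mul_le_mul_of_nonneg_right ?_ (Real.exp_pos _).le)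
      (mul_nonneg (FracTrunc.l2Norm_nonneg _ _) (FracTrunc.l2Norm_nonneg _ _))
    gcongr
    linarith
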